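/- Let $d\ge 1$ and consider $\mathbb R^d$ with Lebesgue measure $dz$. A (measurable) transition density is a Borel function $p:\mathbb R\times\mathbb R^d\times\mathbb R\times\mathbb R^d\to[0,\infty]$ with $\int_{\mathbb R^d} p(s,x,u,z)p(u,z,t,y)\,dz=p(s,x,t,y)$ for all $s<u<t$ and $x,y\in\mathbb R^d$. For a transition density $p$ and a Borel function $q:\mathbb R\times\mathbb R^d\to[0,\infty]$ let $\tilde p=\sum_{n=0}^\infty p_n$, where $p_0=p$ and $$p_n(s,x,t,y)=\int_s^t\int_{\mathbb R^d}p(s,x,u,z)q(u,z)p_{n-1}(u,z,t,y)\,dz\,du ,\qquad n\ge1 .$$ A function $Q:\mathbb R\times\mathbb R\to[0,\infty)$ is called regular superadditive if $Q(s,u)+Q(u,t)\le Q(s,t)$ for $s<u<t$, $Q(s,t)=0$ for $s\ge t$, $s\mapsto Q(s,t)$ is right-continuous and $t\mapsto Q(s,t)$ is left-continuous. We write $q\in\mathcal N(p,p^*,C,\eta,Q)$ if $q:\mathbb R\times\mathbb R^d\to[0,\infty]$ is Borel, $p,p^*$ are transition densities, $C\ge1$, $\eta\ge0$, $Q$ is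 regular superadditive, and for all $s<t$, $x,y\in\mathbb R^d$, $$p(s,x,t,y)\le C\,p^*(s,x,t,y),\qquad \int_s^t\int_{\mathbb R^d}p(s,x,u,z)q(u,z)p^*(u,z,t,y)\,dz\,du\le[\eta+Q(s,t)]\,p^*(s,x,t,y).$$ For $a>0$ let $g_a(s,x,t,y)=[4\pi(t-s)/a]^{-d/2}\exp\{-|y-x|^2/[4(t-s)/a]\}$ if $s<t$, and $g_a(s,x,t,y)=0$ if $s\ge t$. Let $0<a<b$. (1) Let $p$ be a transition density, and let $\Lambda\ge1$ and $\lambda\in\mathbb R$ be such that $p(s,x,t,y)\le\Lambda e^{\lambda(t-s)}g_b(s,x,t,y)$ for all $s<t$ and $x,y\in\mathbb R^d$. Let $C=\Lambda(b/a)^{d/2}$. If $q\in\mathcal N\big(g_b,g_a,\tfrac C\Lambda,\tfrac\eta\Lambda,\tfrac Q\Lambda\big)$, then for all $s<t$, $x,y\in\mathbb R^d$ and $\varepsilon\in(0,1-\eta)$, $$\tilde p(s,x,t,y)\le\Big(\frac{C}{1-\eta-\varepsilon}\Big)^{1+Q(s,t)/\varepsilon}e^{\lambda(t-s)}g_a(s,x,t,y).$$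 (2) Suppose $d\ge3$, $h>0$, and $q$ is time-independent, that is, $q(u,z)=q(z)$ for a Borel function $q:\mathbb R^d\to[0,\infty]$, and $$I_{\sqrt h}(q)=\sup_{x\in\mathbb R^d}\int_{|z-x|<\sqrt h}\frac{q(z)}{|z-x|^{d-2}}\,dz<\infty .$$ Then $q\in\mathcal N(g_b,g_a,(b/a)^{d/2},\eta,Q)$ with $$\eta=b\,c_0(d)\,M\,I_{\sqrt h}(q),\qquad Q(s,t)=(t-s)\,I_{\sqrt h}(q)\,\frac{2M}{|B(0,1/2)|\,h}\ \text{ for } s<t,\qquad Q(s,t)=0\ \text{ for } s\ge t,$$ where $c_0(d)=\Gamma(d/2-1)\pi^{-d/2}/4$, $|B(0,1/2)|$ is the volume of the ball of radius $1/2$ in $\mathbb R^d$, and $$M=\Big(\frac b{b-a}\Big)^{d/2}\exp\Big[\frac d2L\Big(\frac a{b-a}\Big)\Big],\qquad L(\alpha)=\max_{\tau\ge\max(\alpha,1/\alpha)}\Big[\ln(1+\tau)-\frac{\tau-\alpha}{1+\tau}\ln(\alpha\tau)\Big].$$ -/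

import Mathlib

open MeasureTheory Set
open scoped ENNReal

noncomputable section

namespace SchrodingerPerturbation

section General

variable {X : Type*} [MeasurableSpace X]

/-- A measurable transition density on the space-time `ℝ × X`: a jointly measurable function
`p (s, x, t, y)` with values in `[0, ∞]` which satisfies the Chapman-Kolmogorov equations with
respect to the measure `m` on `X`. -/
structure IsTransitionDensity (m : Measure X) (p : ℝ → X → ℝ → X → ℝ≥0∞) : Prop where
  measurable : Measurable fun w : ℝ × X × ℝ × X => p w.1 w.2.1 w.2.2.1 w.2.2.2
  chapman_kolmogorov : ∀ (s u t : ℝ) (x y : X), s < u → u < t →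
    ∫⁻ z, p s x u z * p u z t y ∂m = p s x t y

/-- The integral `∫_s^t ∫_X p(s,x,u,z) q(u,z) r(u,z,t,y) dz du`. -/
def iteration (m : Measure X) (p : ℝ → X → ℝ → X → ℝ≥0∞) (q : ℝ → X → ℝ≥0∞)
    (r : ℝ → X → ℝ → X → ℝ≥0∞) (s : ℝ) (x : X) (t : ℝ) (y : X) : ℝ≥0∞ :=
  ∫⁻ u in Ioo s t, ∫⁻ z, p s x u z * q u z * r u z t y ∂m

/-- The terms `p_n` of the perturbation series: `p_0 = p` and
`p_{n+1}(s,x,t,y) = ∫_s^t ∫_X p(s,x,u,z) q(u,z) p_n(u,z,t,y) dz du`. -/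
def seriesTerm (m : Measure X) (p : ℝ → X → ℝ → X → ℝ≥0∞) (q : ℝ → X → ℝ≥0∞) :
    ℕ → ℝ → X → ℝ → X → ℝ≥0∞
  | 0 => p
  | n + 1 => iteration m p q (seriesTerm m p q n)

/-- The Schrödinger perturbation of `p` by `q`, the sum of `p_n` over `n ≥ 0`. -/
def perturbation (m : Measure X) (p : ℝ → X → ℝ → X → ℝ≥0∞) (q : ℝ → X → ℝ≥0∞)
    (s : ℝ) (x : X) (t : ℝ) (y : X) : ℝ≥0∞ :=
  ∑' n : ℕ, seriesTerm m p q n s x t y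

/-- Regular superadditive functions `Q : ℝ × ℝ → [0, ∞)`. -/
structure RegularSuperadditive (Q : ℝ → ℝ → ℝ) : Prop where
  nonneg : ∀ s t, 0 ≤ Q s t
  superadditive : ∀ s u t, s < u → u < t → Q s u + Q u t ≤ Q s t
  eq_zero : ∀ s t, t ≤ s → Q s t = 0
  right_continuous : ∀ s t, ContinuousWithinAt (fun r => Q r t) (Ici s) s
  left_continuous : ∀ s t, ContinuousWithinAt (fun r => Q s r) (Iic t) t

/-- The condition `q ∈ 𝒩(p, p*, C, η, Q)`; here `ps` stands for `p*`. -/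
structure MemN (m : Measure X) (p ps : ℝ → X → ℝ → X → ℝ≥0∞) (C η : ℝ) (Q : ℝ → ℝ → ℝ)
    (q : ℝ → X → ℝ≥0∞) : Prop where
  measurable : Measurable fun w : ℝ × X => q w.1 w.2
  transitionDensity : IsTransitionDensity m p
  transitionDensity_majorant : IsTransitionDensity m ps
  one_le : 1 ≤ C
  eta_nonneg : 0 ≤ η
  regular : RegularSuperadditive Q
  le_majorant : ∀ (s t : ℝ) (x y : X), s < t → p s x t y ≤ ENNReal.ofReal C * ps s x t y
  integral_le : ∀ (s t : ℝ) (x y : X), s < t →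
    iteration m p q ps s x t y ≤ ENNReal.ofReal (η + Q s t) * ps s x t y

end General

/-- The Gaussian kernel
`g_a(s,x,t,y) = [4π(t-s)/a]^{-d/2} exp(-|y-x|² / [4(t-s)/a])` for `s < t`, and `0` for `s ≥ t`. -/
def gaussKernel (d : ℕ) (a : ℝ) (s : ℝ) (x : EuclideanSpace ℝ (Fin d)) (t : ℝ)
    (y : EuclideanSpace ℝ (Fin d)) : ℝ≥0∞ :=
  if s < t then
    ENNReal.ofReal ((4 * Real.pi * (t - s) / a) ^ (-((d : ℝ) / 2)) *
      Real.exp (-(‖y - x‖ ^ 2 / (4 * (t - s) / a))))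
  else 0

/-- `I_δ(U) = sup_x ∫_{|z-x|<δ} U(z) / |z-x|^{d-2} dz` for `U : ℝ^d → [0, ∞]`. -/
def katoSup (d : ℕ) (δ : ℝ) (U : EuclideanSpace ℝ (Fin d) → ℝ≥0∞) : ℝ≥0∞ :=
  ⨆ x : EuclideanSpace ℝ (Fin d),
    ∫⁻ z in {z | ‖z - x‖ < δ}, U z / ENNReal.ofReal (‖z - x‖ ^ ((d : ℝ) - 2))

/-- `c_0(d) = Γ(d/2 - 1) π^{-d/2} / 4`. -/
def c0 (d : ℕ) : ℝ := Real.Gamma ((d : ℝ) / 2 - 1) * Real.pi ^ (-((d : ℝ) / 2)) / 4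

/-- `L(α)`, the maximum of `ln(1+τ) - (τ-α)/(1+τ) ln(ατ)` over `τ ≥ α ∨ 1/α`. -/
def fourGExponent (α : ℝ) : ℝ :=
  sSup ((fun τ : ℝ => Real.log (1 + τ) - (τ - α) / (1 + τ) * Real.log (α * τ)) ''
    Ici (max α (1 / α)))

/-- `M = (b/(b-a))^{d/2} exp((d/2) L(a/(b-a)))`, the constant of the 4G inequality. -/
def fourGConst (d : ℕ) (a b : ℝ) : ℝ :=
  (b / (b - a)) ^ ((d : ℝ) / 2) * Real.exp ((d : ℝ) / 2 * fourGExponent (a / (b - a)))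

/-- `|B(0,1/2)|`, the volume of the ball of radius `1/2` in `ℝ^d`. -/
def halfBallVolume (d : ℕ) : ℝ :=
  (volume (Metric.ball (0 : EuclideanSpace ℝ (Fin d)) (1 / 2))).toReal

end SchrodingerPerturbation

end

/-!
Schrödinger perturbations of transition densities, with Gaussian bounds.

*The general bound.* If `q ∈ 𝒩(p, p*, C, η, Q)`, then iterating the integral condition gives
`p_n ≤ (η + Q)^n C p*`, so on an interval with `Q ≤ ε` the series is dominated by a geometric one
and the perturbation is at most `A p*` with `A = C / (1 - η - ε)`
(`MemN.perturbation_le_of_lt_one`). Regularity and superadditivity of `Q` cut `[s, t]` into at most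
`1 + Q(s,t)/ε` intervals of this kind (`RegularSuperadditive.exists_split`). The perturbation
satisfies Chapman-Kolmogorov (`perturbation_chapman_kolmogorov`), because the `n`-th term over
`[s, t]` splits at an intermediate time according to how many factors `q` fall before it. Gluing the
pieces together and using Chapman-Kolmogorov for `p*` bounds the perturbation by a power of `A`
times `p*` (`MemN.perturbation_le`). A density below `Λ e^{λ(t-s)} g_b` is then handled by the
majorant `p* = e^{λ(t-s)} g_a` (`MemN.of_le_exp_mul`).

*Membership of Kato potentials.* The 4G inequality
`g_b(s,x,u,z) g_a(u,z,t,y) ≤ M g_a(s,x,t,y) [g_{b-a}(s,x,u,z) + g_a(u,z,t,y)]`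
(`gaussKernel_mul_le`), whose scalar core is `fourG_alternative`, reduces the integral condition to
the heat potentials of `q` at `x` and at `y`. Within distance `√h` of the pole, the time integral of
`g_a` is at most `a c₀ |z - x|^{2-d}` (`integral_gaussProfile`), and `(b - a) + a = b` produces `η`.
Farther away, the Gaussian at `z` is at most its average over a ball of radius `√h / 2` near `z`, so
that its total mass `1` controls the integral against `q` at each time
(`volume_ball_mul_lintegral_le`); integrating in time produces the linear function `Q`.
-/

namespace SchrodingerPerturbation

section

variable {X : Type*} [MeasurableSpace X] {m : Measure X}

/-! ### Chapman-Kolmogorov for the perturbation series -/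

theorem measurable_iteration [SFinite m] {p r : ℝ → X → ℝ → X → ℝ≥0∞} {q : ℝ → X → ℝ≥0∞}
    (hp : Measurable fun w : ℝ × X × ℝ × X => p w.1 w.2.1 w.2.2.1 w.2.2.2)
    (hq : Measurable fun w : ℝ × X => q w.1 w.2)
    (hr : Measurable fun w : ℝ × X × ℝ × X => r w.1 w.2.1 w.2.2.1 w.2.2.2) :
    Measurable fun w : ℝ × X × ℝ × X => iteration m p q r w.1 w.2.1 w.2.2.1 w.2.2.2 := by
  have h1 : Measurable fun v : ((ℝ × X × ℝ × X) × ℝ) × X =>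
      p v.1.1.1 v.1.1.2.1 v.1.2 v.2 * q v.1.2 v.2 * r v.1.2 v.2 v.1.1.2.2.1 v.1.1.2.2.2 := by
    refine Measurable.mul (Measurable.mul ?_ ?_) ?_
    · exact hp.comp (g := fun w : ℝ × X × ℝ × X => p w.1 w.2.1 w.2.2.1 w.2.2.2)
        (f := fun v : ((ℝ × X × ℝ × X) × ℝ) × X => (v.1.1.1, v.1.1.2.1, v.1.2, v.2)) (by fun_prop)
    · exact hq.comp (g := fun w : ℝ × X => q w.1 w.2)
        (f := fun v : ((ℝ × X × ℝ × X) × ℝ) × X => (v.1.2, v.2)) (by fun_prop)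
    · exact hr.comp (g := fun w : ℝ × X × ℝ × X => r w.1 w.2.1 w.2.2.1 w.2.2.2)
        (f := fun v : ((ℝ × X × ℝ × X) × ℝ) × X =>
          (v.1.2, v.2, v.1.1.2.2.1, v.1.1.2.2.2)) (by fun_prop)
  have h2 : MeasurableSet {v : (ℝ × X × ℝ × X) × ℝ | v.1.1 < v.2 ∧ v.2 < v.1.2.2.1} :=
    MeasurableSet.inter
      (measurableSet_lt (f := fun v : (ℝ × X × ℝ × X) × ℝ => v.1.1) (by fun_prop) (by fun_prop))
      (measurableSet_lt (g := fun v : (ℝ × X × ℝ × X) × ℝ => v.1.2.2.1)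
        (by fun_prop) (by fun_prop))
  convert ((h1.lintegral_prod_right' (ν := m)).indicator h2).lintegral_prod_right'
    (ν := volume) using 2 with w
  rw [iteration, ← lintegral_indicator measurableSet_Ioo]
  rfl

theorem measurable_seriesTerm [SFinite m] {p : ℝ → X → ℝ → X → ℝ≥0∞} {q : ℝ → X → ℝ≥0∞}
    (hp : Measurable fun w : ℝ × X × ℝ × X => p w.1 w.2.1 w.2.2.1 w.2.2.2)
    (hq : Measurable fun w : ℝ × X => q w.1 w.2) (n : ℕ) :
    Measurable fun w : ℝ × X × ℝ × X => seriesTerm m p q n w.1 w.2.1 w.2.2.1 w.2.2.2 := by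
  induction n with
  | zero => exact hp
  | succ n ih => exact measurable_iteration hp hq ih

/-- The Chapman-Kolmogorov equation of the perturbation, graded by the number of factors `q`. -/
theorem seriesTerm_eq_sum_antidiagonal [SFinite m] {p : ℝ → X → ℝ → X → ℝ≥0∞}
    {q : ℝ → X → ℝ≥0∞} (hp : IsTransitionDensity m p)
    (hq : Measurable fun w : ℝ × X => q w.1 w.2) (n : ℕ) :
    ∀ {s u t : ℝ} (x y : X), s < u → u < t → seriesTerm m p q n s x t y =
      ∑ k ∈ Finset.HasAntidiagonal.antidiagonal n,
        ∫⁻ z, seriesTerm m p q k.1 s x u z * seriesTerm m p q k.2 u z t y ∂m := by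
  have hm := measurable_seriesTerm (m := m) hp.measurable hq
  -- measurability of every slice and of every joint section of the terms
  have hP : ∀ (n : ℕ) {β : Type _} [MeasurableSpace β] {f : β → ℝ} {g : β → X} {f' : β → ℝ}
      {g' : β → X}, Measurable f → Measurable g → Measurable f' → Measurable g' →
      Measurable fun b => seriesTerm m p q n (f b) (g b) (f' b) (g' b) := by
    intro n β _ f g f' g' hf hg hf' hg'
    exact (hm n).comp (g := fun w : ℝ × X × ℝ × X => seriesTerm m p q n w.1 w.2.1 w.2.2.1 w.2.2.2)
      (hf.prodMk (hg.prodMk (hf'.prodMk hg')))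
  have hQ : ∀ {β : Type _} [MeasurableSpace β] {f : β → ℝ} {g : β → X}, Measurable f →
      Measurable g → Measurable fun b => q (f b) (g b) := by
    intro β _ f g hf hg
    exact hq.comp (g := fun w : ℝ × X => q w.1 w.2) (hf.prodMk hg)
  induction n with
  | zero =>
    intro s u t x y hsu hut
    simpa [seriesTerm] using (hp.chapman_kolmogorov s u t x y hsu hut).symm
  | succ n ih =>
    intro s u t x y hsu hut
    have split : seriesTerm m p q (n + 1) s x t y =
        (∫⁻ r in Ioo s u, ∫⁻ w, p s x r w * q r w * seriesTerm m p q n r w t y ∂m) +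
        ∫⁻ r in Ioo u t, ∫⁻ w, p s x r w * q r w * seriesTerm m p q n r w t y ∂m := by
      simp only [seriesTerm, iteration]
      rw [setLIntegral_congr Ioo_ae_eq_Ioc, ← Ioc_union_Ioc_eq_Ioc hsu.le hut.le,
        lintegral_union measurableSet_Ioc (Ioc_disjoint_Ioc_of_le le_rfl),
        setLIntegral_congr Ioo_ae_eq_Ioc, setLIntegral_congr Ioo_ae_eq_Ioc]
    rw [split, Finset.Nat.sum_antidiagonal_succ, add_comm]
    congr 1
    · -- for `r > u`, split `p (s, x, r, w)` at time `u`
      have e1 : ∀ r ∈ Ioo u t, ∫⁻ w, p s x r w * q r w * seriesTerm m p q n r w t y ∂m =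
          ∫⁻ z, p s x u z * ∫⁻ w, p u z r w * q r w * seriesTerm m p q n r w t y ∂m ∂m := by
        intro r hr
        calc _ = ∫⁻ w, ∫⁻ z, p s x u z * (p u z r w * q r w * seriesTerm m p q n r w t y)
              ∂m ∂m := by
              refine lintegral_congr fun w => ?_
              rw [← hp.chapman_kolmogorov s u r x w hsu hr.1, mul_assoc, ← lintegral_mul_const]
              · exact lintegral_congr fun z => by ring
              · exact (hP 0 (by fun_prop) (by fun_prop) (by fun_prop) (by fun_prop)).mul
                  (hP 0 (by fun_prop) (by fun_prop) (by fun_prop) (by fun_prop))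
          _ = _ := by
              rw [lintegral_lintegral_swap]
              · refine lintegral_congr fun z => lintegral_const_mul _ ?_
                exact ((hP 0 (by fun_prop) (by fun_prop) (by fun_prop) (by fun_prop)).mul
                  (hQ (by fun_prop) (by fun_prop))).mul
                  (hP n (by fun_prop) (by fun_prop) (by fun_prop) (by fun_prop))
              · exact ((hP 0 (by fun_prop) (by fun_prop) (by fun_prop) (by fun_prop)).mul
                  (((hP 0 (by fun_prop) (by fun_prop) (by fun_prop) (by fun_prop)).mul
                  (hQ (by fun_prop) (by fun_prop))).mul
                  (hP n (by fun_prop) (by fun_prop) (by fun_prop) (by fun_prop)))).aemeasurable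
      have hinner : Measurable fun v : ℝ × X =>
          ∫⁻ w, p u v.2 v.1 w * q v.1 w * seriesTerm m p q n v.1 w t y ∂m := by
        refine Measurable.lintegral_prod_right' (f := fun v : (ℝ × X) × X =>
          p u v.1.2 v.1.1 v.2 * q v.1.1 v.2 * seriesTerm m p q n v.1.1 v.2 t y) ?_
        exact ((hP 0 (by fun_prop) (by fun_prop) (by fun_prop) (by fun_prop)).mul
                  (hQ (by fun_prop) (by fun_prop))).mul
                  (hP n (by fun_prop) (by fun_prop) (by fun_prop) (by fun_prop))
      rw [setLIntegral_congr_fun measurableSet_Ioo e1, lintegral_lintegral_swap]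
      · refine lintegral_congr fun z => lintegral_const_mul _ ?_
        exact hinner.comp (measurable_id.prodMk measurable_const)
      · exact ((hP 0 (by fun_prop) (by fun_prop) (by fun_prop) (by fun_prop)).mul
          hinner).aemeasurable
    · -- for `r < u`, split the term `n` at time `u`
      have hin : ∀ k : ℕ, Measurable fun v : ℝ × X =>
          ∫⁻ w, p s x v.1 w * q v.1 w * seriesTerm m p q k v.1 w u v.2 ∂m := by
        intro k
        refine Measurable.lintegral_prod_right' (f := fun v : (ℝ × X) × X =>
          p s x v.1.1 v.2 * q v.1.1 v.2 * seriesTerm m p q k v.1.1 v.2 u v.1.2) ?_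
        exact ((hP 0 (by fun_prop) (by fun_prop) (by fun_prop) (by fun_prop)).mul
                  (hQ (by fun_prop) (by fun_prop))).mul
                  (hP k (by fun_prop) (by fun_prop) (by fun_prop) (by fun_prop))
      have e1 : ∀ r ∈ Ioo s u, ∫⁻ w, p s x r w * q r w * seriesTerm m p q n r w t y ∂m =
          ∑ k ∈ Finset.HasAntidiagonal.antidiagonal n, ∫⁻ z,
            (∫⁻ w, p s x r w * q r w * seriesTerm m p q k.1 r w u z ∂m) *
              seriesTerm m p q k.2 u z t y ∂m := by
        intro r hr
        have e2 : ∀ w, p s x r w * q r w * seriesTerm m p q n r w t y =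
            ∑ k ∈ Finset.HasAntidiagonal.antidiagonal n, ∫⁻ z, p s x r w * q r w *
              seriesTerm m p q k.1 r w u z * seriesTerm m p q k.2 u z t y ∂m := by
          intro w
          rw [ih w y hr.2 hut, Finset.mul_sum]
          refine Finset.sum_congr rfl fun k _ => ?_
          rw [← lintegral_const_mul]
          · exact lintegral_congr fun z => by ring
          · exact (hP k.1 (by fun_prop) (by fun_prop) (by fun_prop) (by fun_prop)).mul
              (hP k.2 (by fun_prop) (by fun_prop) (by fun_prop) (by fun_prop))
        have hjoint : ∀ k : ℕ × ℕ, Measurable fun v : X × X => p s x r v.1 * q r v.1 *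
              seriesTerm m p q k.1 r v.1 u v.2 * seriesTerm m p q k.2 u v.2 t y := fun k =>
          (((hP 0 (by fun_prop) (by fun_prop) (by fun_prop) (by fun_prop)).mul
                  (hQ (by fun_prop) (by fun_prop))).mul
            (hP k.1 (by fun_prop) (by fun_prop) (by fun_prop) (by fun_prop))).mul
            (hP k.2 (by fun_prop) (by fun_prop) (by fun_prop) (by fun_prop))
        rw [lintegral_congr e2, lintegral_finsetSum]
        · refine Finset.sum_congr rfl fun k _ => ?_
          rw [lintegral_lintegral_swap (hjoint k).aemeasurable]
          refine lintegral_congr fun z => lintegral_mul_const _ ?_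
          exact ((hP 0 (by fun_prop) (by fun_prop) (by fun_prop) (by fun_prop)).mul
                  (hQ (by fun_prop) (by fun_prop))).mul
            (hP k.1 (by fun_prop) (by fun_prop) (by fun_prop) (by fun_prop))
        · exact fun k _ => (hjoint k).lintegral_prod_right'
      have hjoint : ∀ k : ℕ × ℕ, Measurable fun v : ℝ × X =>
            (∫⁻ w, p s x v.1 w * q v.1 w * seriesTerm m p q k.1 v.1 w u v.2 ∂m) *
              seriesTerm m p q k.2 u v.2 t y := fun k =>
        (hin k.1).mul (hP k.2 (by fun_prop) (by fun_prop) (by fun_prop) (by fun_prop))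
      rw [setLIntegral_congr_fun measurableSet_Ioo e1, lintegral_finsetSum]
      · refine Finset.sum_congr rfl fun k _ => ?_
        rw [lintegral_lintegral_swap (hjoint k).aemeasurable]
        refine lintegral_congr fun z => lintegral_mul_const _ ?_
        exact (hin k.1).comp (measurable_id.prodMk measurable_const)
      · exact fun k _ => (hjoint k).lintegral_prod_right'

/-- The perturbation inherits the Chapman-Kolmogorov equation. -/
theorem perturbation_chapman_kolmogorov [SFinite m] {p : ℝ → X → ℝ → X → ℝ≥0∞}
    {q : ℝ → X → ℝ≥0∞} (hp : IsTransitionDensity m p)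
    (hq : Measurable fun w : ℝ × X => q w.1 w.2) {s u t : ℝ} (x y : X) (hsu : s < u)
    (hut : u < t) :
    perturbation m p q s x t y =
      ∫⁻ z, perturbation m p q s x u z * perturbation m p q u z t y ∂m := by
  have hm := measurable_seriesTerm (m := m) hp.measurable hq
  have hmeas : ∀ i j : ℕ, Measurable fun z =>
      seriesTerm m p q i s x u z * seriesTerm m p q j u z t y := fun i j =>
    ((hm i).comp (f := fun z => (s, x, u, z)) (by fun_prop)).mul
      ((hm j).comp (f := fun z => (u, z, t, y)) (by fun_prop))
  have e : ∀ z, perturbation m p q s x u z * perturbation m p q u z t y =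
      ∑' k : ℕ × ℕ, seriesTerm m p q k.1 s x u z * seriesTerm m p q k.2 u z t y := by
    intro z
    rw [perturbation, perturbation, ENNReal.tsum_prod
      (f := fun i j => seriesTerm m p q i s x u z * seriesTerm m p q j u z t y),
      ← ENNReal.tsum_mul_right]
    exact tsum_congr fun i => ENNReal.tsum_mul_left.symm
  rw [lintegral_congr e, lintegral_tsum
      (f := fun (k : ℕ × ℕ) z => seriesTerm m p q k.1 s x u z * seriesTerm m p q k.2 u z t y)
      fun k => (hmeas k.1 k.2).aemeasurable,
    ← Finset.HasAntidiagonal.sigmaAntidiagonalEquivProd.tsum_eq, ENNReal.tsum_sigma', perturbation]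
  refine tsum_congr fun n => ?_
  rw [seriesTerm_eq_sum_antidiagonal hp hq n x y hsu hut, tsum_fintype, Finset.univ_eq_attach]
  exact (Finset.sum_attach (Finset.HasAntidiagonal.antidiagonal n)
    (fun k => ∫⁻ z, seriesTerm m p q k.1 s x u z * seriesTerm m p q k.2 u z t y ∂m)).symm

end

section

/-! ### Bounds for the perturbation series -/

variable {X : Type*} [MeasurableSpace X] {m : Measure X}

theorem RegularSuperadditive.le_of_lt {Q : ℝ → ℝ → ℝ} (hQ : RegularSuperadditive Q) {s u t : ℝ}
    (hsu : s < u) (hut : u < t) : Q u t ≤ Q s t := by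
  linarith [hQ.superadditive s u t hsu hut, hQ.nonneg s u]

/-- A first piece of `[s, t]` on which `Q` is at most `ε` and whose removal lowers `Q` by at
least `ε`. Left-continuity makes `Q s u ≤ ε` hold at the supremum `u` of all such times, and
right-continuity carries the superadditivity bound at times past `u` over to `u`. -/
theorem RegularSuperadditive.exists_split {Q : ℝ → ℝ → ℝ} (hQ : RegularSuperadditive Q)
    {s t ε : ℝ} (hst : s < t) (hε : 0 < ε) (h : ε < Q s t) :
    ∃ u, s < u ∧ u < t ∧ Q s u ≤ ε ∧ Q u t ≤ Q s t - ε := by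
  set S : Set ℝ := {u | u ∈ Icc s t ∧ Q s u ≤ ε} with hS
  have hsS : s ∈ S := ⟨⟨le_rfl, hst.le⟩, by rw [hQ.eq_zero s s le_rfl]; exact hε.le⟩
  have hbdd : BddAbove S := ⟨t, fun u hu => hu.1.2⟩
  set u := sSup S with hu
  have hsu : s ≤ u := le_csSup hbdd hsS
  have hut : u ≤ t := csSup_le ⟨s, hsS⟩ fun v hv => hv.1.2
  have h1 : Q s u ≤ ε := by
    have hc : ContinuousWithinAt (fun r => Q s r) S u :=
      (hQ.left_continuous s u).mono fun v hv => le_csSup hbdd hv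
    have := hc.mem_closure (csSup_mem_closure ⟨s, hsS⟩ hbdd)
      (show MapsTo (fun r => Q s r) S (Iic ε) from fun v hv => hv.2)
    rwa [isClosed_Iic.closure_eq] at this
  have hut' : u < t := hut.lt_of_ne fun he => by rw [he] at h1; linarith
  have h2 : Q u t ≤ Q s t - ε := by
    have hc : ContinuousWithinAt (fun r => Q r t) (Ioo u t) u :=
      (hQ.right_continuous u t).mono fun v hv => hv.1.le
    have hmem : u ∈ closure (Ioo u t) := by
      rw [closure_Ioo hut'.ne]; exact ⟨le_rfl, hut⟩
    have := hc.mem_closure hmem (show MapsTo (fun r => Q r t) (Ioo u t) (Iic (Q s t - ε)) by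
      intro v hv
      have hsv : s < v := hsu.trans_lt hv.1
      have : ε < Q s v := by
        by_contra! hle
        exact absurd (le_csSup hbdd (show v ∈ S from ⟨⟨hsv.le, hv.2.le⟩, hle⟩)) (not_le.2 hv.1)
      have := hQ.superadditive s v t hsv hv.2
      simp only [mem_Iic]
      linarith)
    rwa [isClosed_Iic.closure_eq] at this
  refine ⟨u, hsu.lt_of_ne fun he => ?_, hut', h1, h2⟩
  rw [← he] at h2
  linarith

variable {p ps : ℝ → X → ℝ → X → ℝ≥0∞} {C η : ℝ} {Q : ℝ → ℝ → ℝ} {q : ℝ → X → ℝ≥0∞}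

theorem iteration_le_const_mul {r r' : ℝ → X → ℝ → X → ℝ≥0∞} {c : ℝ≥0∞} (hc : c ≠ ∞)
    {s t : ℝ} {x y : X} (h : ∀ u ∈ Ioo s t, ∀ z, r u z t y ≤ c * r' u z t y) :
    iteration m p q r s x t y ≤ c * iteration m p q r' s x t y := by
  simp only [iteration]
  rw [← lintegral_const_mul' _ _ hc]
  refine setLIntegral_mono' measurableSet_Ioo fun u hu => ?_
  rw [← lintegral_const_mul' _ _ hc]
  refine lintegral_mono fun z => ?_
  calc _ ≤ p s x u z * q u z * (c * r' u z t y) := by gcongr; exact h u hu z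
    _ = _ := by ring

/-- Iterating the integral condition; `Q(u, t) ≤ Q(s, t)` lets the constant be pulled out. -/
theorem MemN.seriesTerm_le (h : MemN m p ps C η Q q) (n : ℕ) {s t : ℝ} (x y : X) (hst : s < t) :
    seriesTerm m p q n s x t y ≤
      ENNReal.ofReal (η + Q s t) ^ n * (ENNReal.ofReal C * ps s x t y) := by
  induction n generalizing s x with
  | zero => simpa [seriesTerm] using h.le_majorant s t x y hst
  | succ n ih =>
    have hc : ENNReal.ofReal (η + Q s t) ^ n * ENNReal.ofReal C ≠ ∞ :=
      ENNReal.mul_ne_top (ENNReal.pow_ne_top ENNReal.ofReal_ne_top) ENNReal.ofReal_ne_top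
    calc seriesTerm m p q (n + 1) s x t y
        ≤ ENNReal.ofReal (η + Q s t) ^ n * ENNReal.ofReal C * iteration m p q ps s x t y := by
          refine iteration_le_const_mul hc fun u hu z => (ih z hu.2).trans ?_
          rw [mul_assoc]
          gcongr
          exact h.regular.le_of_lt hu.1 hu.2
      _ ≤ ENNReal.ofReal (η + Q s t) ^ n * ENNReal.ofReal C *
          (ENNReal.ofReal (η + Q s t) * ps s x t y) := by
          gcongr
          exact h.integral_le s t x y hst
      _ = _ := by ring

/-- On intervals where `η + Q < 1`, the series is dominated by a geometric one. -/
theorem MemN.perturbation_le_of_lt_one (h : MemN m p ps C η Q q) {s t ρ : ℝ} (x y : X)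
    (hst : s < t) (hρ : η + Q s t ≤ ρ) (hρ1 : ρ < 1) :
    perturbation m p q s x t y ≤ ENNReal.ofReal (C / (1 - ρ)) * ps s x t y := by
  have hρ0 : 0 ≤ ρ := (add_nonneg h.eta_nonneg (h.regular.nonneg s t)).trans hρ
  calc perturbation m p q s x t y
      ≤ ∑' n : ℕ, ENNReal.ofReal ρ ^ n * (ENNReal.ofReal C * ps s x t y) := by
        refine ENNReal.tsum_le_tsum fun n => (h.seriesTerm_le n x y hst).trans ?_
        gcongr
    _ = ENNReal.ofReal (C / (1 - ρ)) * ps s x t y := by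
        rw [ENNReal.tsum_mul_right, ENNReal.tsum_geometric, ← mul_assoc,
          ENNReal.ofReal_div_of_pos (by linarith), ENNReal.ofReal_sub 1 hρ0, ENNReal.ofReal_one,
          ENNReal.div_eq_inv_mul]

/-- Gluing of the bounds over consecutive intervals with `Q ≤ ε`: each step removes one interval
and lowers `Q` by at least `ε`. -/
theorem MemN.perturbation_le_pow [SFinite m] (h : MemN m p ps C η Q q) {ε : ℝ} (hε : 0 < ε)
    (hε1 : ε < 1 - η) (k : ℕ) {s t : ℝ} (x y : X) (hst : s < t) (hk : Q s t ≤ (k + 1 : ℕ) * ε) :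
    perturbation m p q s x t y ≤ ENNReal.ofReal (C / (1 - η - ε)) ^ (k + 1) * ps s x t y := by
  have hA : 1 ≤ C / (1 - η - ε) := by
    rw [one_le_div (by linarith)]
    linarith [h.one_le, h.eta_nonneg]
  have small : ∀ {s t : ℝ} (x y : X), s < t → Q s t ≤ ε →
      perturbation m p q s x t y ≤ ENNReal.ofReal (C / (1 - η - ε)) * ps s x t y := by
    intro s t x y hst hle
    have := h.perturbation_le_of_lt_one x y hst (ρ := η + ε) (by linarith) (by linarith)
    rwa [← sub_sub] at this
  induction k generalizing s x with
  | zero => simpa using small x y hst (by simpa using hk)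
  | succ k ih =>
    by_cases hle : Q s t ≤ ε
    · refine (small x y hst hle).trans ?_
      gcongr
      exact le_self_pow₀ (by simpa using hA) (by simp)
    · obtain ⟨u, hsu, hut, h1, h2⟩ := h.regular.exists_split hst hε (not_le.1 hle)
      have h3 : Q u t ≤ (k + 1 : ℕ) * ε := by
        push_cast at hk ⊢
        linarith
      rw [perturbation_chapman_kolmogorov h.transitionDensity h.measurable x y hsu hut,
        ← h.transitionDensity_majorant.chapman_kolmogorov s u t x y hsu hut,
        ← lintegral_const_mul' _ _ (ENNReal.pow_ne_top ENNReal.ofReal_ne_top)]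
      refine lintegral_mono fun z => ?_
      calc _ ≤ (ENNReal.ofReal (C / (1 - η - ε)) * ps s x u z) *
            (ENNReal.ofReal (C / (1 - η - ε)) ^ (k + 1) * ps u z t y) :=
            mul_le_mul' (small x z hsu h1) (ih z hut h3)
        _ = _ := by ring

/-- The pointwise bound of the perturbation of a kernel of class `𝒩`. -/
theorem MemN.perturbation_le [SFinite m] (h : MemN m p ps C η Q q) {ε : ℝ} (hε : 0 < ε)
    (hε1 : ε < 1 - η) {s t : ℝ} (x y : X) (hst : s < t) :
    perturbation m p q s x t y ≤
      ENNReal.ofReal ((C / (1 - η - ε)) ^ (1 + Q s t / ε)) * ps s x t y := by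
  have hA : 1 ≤ C / (1 - η - ε) := by
    rw [one_le_div (by linarith)]
    linarith [h.one_le, h.eta_nonneg]
  have hQ : 0 ≤ Q s t / ε := div_nonneg (h.regular.nonneg s t) hε.le
  refine (h.perturbation_le_pow hε hε1 ⌊Q s t / ε⌋₊ x y hst ?_).trans ?_
  · rw [← div_le_iff₀ hε]
    exact_mod_cast (Nat.lt_floor_add_one (Q s t / ε)).le
  · gcongr
    rw [← ENNReal.ofReal_pow (by linarith), ← Real.rpow_natCast]
    refine ENNReal.ofReal_le_ofReal (Real.rpow_le_rpow_of_exponent_le hA ?_)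
    push_cast
    linarith [Nat.floor_le hQ]

end

/-! ### Exponential rescaling of transition densities -/

section Rescaling

variable {X : Type*} [MeasurableSpace X] {m : Measure X}

theorem IsTransitionDensity.exp_mul {p : ℝ → X → ℝ → X → ℝ≥0∞} (hp : IsTransitionDensity m p)
    (lam : ℝ) :
    IsTransitionDensity m
      (fun s x t y => ENNReal.ofReal (Real.exp (lam * (t - s))) * p s x t y) where
  measurable := by
    refine Measurable.mul ?_ hp.measurable
    fun_prop
  chapman_kolmogorov s u t x y hsu hut := by
    rw [← hp.chapman_kolmogorov s u t x y hsu hut,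
      ← lintegral_const_mul' _ _ ENNReal.ofReal_ne_top]
    refine lintegral_congr fun z => ?_
    have : Real.exp (lam * (t - s)) = Real.exp (lam * (u - s)) * Real.exp (lam * (t - u)) := by
      rw [← Real.exp_add]
      ring_nf
    rw [this, ENNReal.ofReal_mul (Real.exp_pos _).le]
    ring

theorem RegularSuperadditive.const_mul {Q : ℝ → ℝ → ℝ} (hQ : RegularSuperadditive Q) {c : ℝ}
    (hc : 0 ≤ c) : RegularSuperadditive fun s t => c * Q s t where
  nonneg s t := mul_nonneg hc (hQ.nonneg s t)
  superadditive s u t hsu hut := by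
    rw [← mul_add]
    exact mul_le_mul_of_nonneg_left (hQ.superadditive s u t hsu hut) hc
  eq_zero s t h := by rw [hQ.eq_zero s t h, mul_zero]
  right_continuous s t := (hQ.right_continuous s t).const_mul c
  left_continuous s t := (hQ.left_continuous s t).const_mul c

/-- A kernel dominated by `Λ e^{λ(t-s)} p₁`, with `q ∈ 𝒩(p₁, p*, C, η, Q)`, satisfies
`q ∈ 𝒩(p, e^{λ(t-s)} p*, Λ C, Λ η, Λ Q)`: the exponential factors over `[s, u]` and `[u, t]`
multiply to the one over `[s, t]`. -/
theorem MemN.of_le_exp_mul {p p₁ ps : ℝ → X → ℝ → X → ℝ≥0∞} {C η : ℝ} {Q : ℝ → ℝ → ℝ}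
    {q : ℝ → X → ℝ≥0∞} (h : MemN m p₁ ps C η Q q) (hp : IsTransitionDensity m p) {Lam lam : ℝ}
    (hLam : 1 ≤ Lam)
    (hle : ∀ (s t : ℝ) (x y : X), s < t →
      p s x t y ≤ ENNReal.ofReal (Lam * Real.exp (lam * (t - s))) * p₁ s x t y) :
    MemN m p (fun s x t y => ENNReal.ofReal (Real.exp (lam * (t - s))) * ps s x t y)
      (Lam * C) (Lam * η) (fun s t => Lam * Q s t) q where
  measurable := h.measurable
  transitionDensity := hp
  transitionDensity_majorant := h.transitionDensity_majorant.exp_mul lam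
  one_le := one_le_mul_of_one_le_of_one_le hLam h.one_le
  eta_nonneg := mul_nonneg (by linarith) h.eta_nonneg
  regular := h.regular.const_mul (by linarith)
  le_majorant s t x y hst := by
    calc p s x t y ≤ ENNReal.ofReal (Lam * Real.exp (lam * (t - s))) *
          (ENNReal.ofReal C * ps s x t y) :=
          (hle s t x y hst).trans (mul_le_mul' le_rfl (h.le_majorant s t x y hst))
      _ = _ := by
          rw [ENNReal.ofReal_mul (by linarith), ENNReal.ofReal_mul (by linarith)]
          ring
  integral_le s t x y hst := by
    have hc : ENNReal.ofReal (Lam * Real.exp (lam * (t - s))) ≠ ∞ := ENNReal.ofReal_ne_top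
    calc iteration m p q (fun s x t y => ENNReal.ofReal (Real.exp (lam * (t - s))) * ps s x t y)
          s x t y
        ≤ ENNReal.ofReal (Lam * Real.exp (lam * (t - s))) * iteration m p₁ q ps s x t y := by
          simp only [iteration]
          rw [← lintegral_const_mul' _ _ hc]
          refine setLIntegral_mono' measurableSet_Ioo fun u hu => ?_
          rw [← lintegral_const_mul' _ _ hc]
          refine lintegral_mono fun z => ?_
          have e : Lam * Real.exp (lam * (t - s)) =
              Lam * Real.exp (lam * (u - s)) * Real.exp (lam * (t - u)) := by
            rw [mul_assoc, ← Real.exp_add]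
            ring_nf
          rw [e, ENNReal.ofReal_mul (mul_nonneg (by linarith) (Real.exp_pos _).le)]
          calc _ ≤ (ENNReal.ofReal (Lam * Real.exp (lam * (u - s))) * p₁ s x u z) * q u z *
                (ENNReal.ofReal (Real.exp (lam * (t - u))) * ps u z t y) := by
                gcongr
                exact hle s u x z hu.1
            _ = _ := by ring
      _ ≤ ENNReal.ofReal (Lam * Real.exp (lam * (t - s))) *
          (ENNReal.ofReal (η + Q s t) * ps s x t y) := by
          gcongr
          exact h.integral_le s t x y hst
      _ = _ := by
          rw [ENNReal.ofReal_mul (by linarith), ← mul_add, ENNReal.ofReal_mul (by linarith)]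
          ring

end Rescaling

/-! ### The Gaussian kernel -/

/-- The Gaussian density of `gaussKernel d a` at time `T` and distance `R`. -/
noncomputable def gaussProfile (d : ℕ) (a T R : ℝ) : ℝ :=
  (4 * Real.pi * T / a) ^ (-((d : ℝ) / 2)) * Real.exp (-(R ^ 2 / (4 * T / a)))

theorem gaussKernel_of_lt {d : ℕ} {a s t : ℝ} (x y : EuclideanSpace ℝ (Fin d)) (hst : s < t) :
    gaussKernel d a s x t y = ENNReal.ofReal (gaussProfile d a (t - s) ‖y - x‖) := by
  simp only [gaussKernel, gaussProfile, if_pos hst]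

theorem gaussProfile_pos (d : ℕ) {a T : ℝ} (R : ℝ) (ha : 0 < a) (hT : 0 < T) :
    0 < gaussProfile d a T R := by
  unfold gaussProfile
  positivity

theorem gaussProfile_eq_exp (d : ℕ) {a T : ℝ} (R : ℝ) (ha : 0 < a) (hT : 0 < T) :
    gaussProfile d a T R = Real.exp (-((d : ℝ) / 2) *
      (Real.log (4 * Real.pi) + Real.log T - Real.log a) - a * R ^ 2 / (4 * T)) := by
  have hpi := Real.pi_pos
  have e : -(R ^ 2 / (4 * T / a)) = -(a * R ^ 2 / (4 * T)) := by field_simp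
  rw [gaussProfile, Real.rpow_def_of_pos (by positivity), ← Real.exp_add,
    Real.log_div (by positivity) ha.ne', Real.log_mul (by positivity) hT.ne', e]
  congr 1
  ring

theorem gaussProfile_antitoneOn (d : ℕ) {a T : ℝ} (ha : 0 < a) (hT : 0 < T) :
    AntitoneOn (gaussProfile d a T) (Ici 0) := by
  intro R hR R' _ h
  rw [gaussProfile_eq_exp d R ha hT, gaussProfile_eq_exp d R' ha hT]
  have : R ^ 2 ≤ R' ^ 2 := pow_le_pow_left₀ hR h 2
  gcongr

theorem measurable_gaussProfile (d : ℕ) (a : ℝ) {β : Type*} [MeasurableSpace β] {f g : β → ℝ}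
    (hf : Measurable f) (hg : Measurable g) :
    Measurable fun v => gaussProfile d a (f v) (g v) := by
  unfold gaussProfile
  fun_prop

theorem lintegral_exp_neg_mul_norm_sub_sq {d : ℕ} {c : ℝ} (hc : 0 < c)
    (x : EuclideanSpace ℝ (Fin d)) :
    ∫⁻ z, ENNReal.ofReal (Real.exp (-c * ‖z - x‖ ^ 2)) =
      ENNReal.ofReal ((Real.pi / c) ^ ((d : ℝ) / 2)) := by
  rw [lintegral_sub_right_eq_self
    (fun z : EuclideanSpace ℝ (Fin d) => ENNReal.ofReal (Real.exp (-c * ‖z‖ ^ 2)))]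
  have h := GaussianFourier.integral_rexp_neg_mul_sq_norm (V := EuclideanSpace ℝ (Fin d)) hc
  rw [finrank_euclideanSpace_fin] at h
  rw [← h, ofReal_integral_eq_lintegral_ofReal]
  · refine .of_integral_ne_zero ?_
    rw [h]
    positivity
  · exact Filter.Eventually.of_forall fun z => (Real.exp_pos _).le

theorem lintegral_gaussProfile {d : ℕ} {a T : ℝ} (ha : 0 < a) (hT : 0 < T)
    (x : EuclideanSpace ℝ (Fin d)) :
    ∫⁻ z, ENNReal.ofReal (gaussProfile d a T ‖z - x‖) = 1 := by
  have hpi := Real.pi_pos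
  have e : ∀ z, ENNReal.ofReal (gaussProfile d a T ‖z - x‖) =
      ENNReal.ofReal ((4 * Real.pi * T / a) ^ (-((d : ℝ) / 2))) *
        ENNReal.ofReal (Real.exp (-(a / (4 * T)) * ‖z - x‖ ^ 2)) := by
    intro z
    rw [← ENNReal.ofReal_mul (by positivity), gaussProfile]
    congr 3
    field_simp
  rw [lintegral_congr e, lintegral_const_mul' _ _ ENNReal.ofReal_ne_top,
    lintegral_exp_neg_mul_norm_sub_sq (by positivity), ← ENNReal.ofReal_mul (by positivity),
    Real.rpow_neg (by positivity)]
  have : Real.pi / (a / (4 * T)) = 4 * Real.pi * T / a := by field_simp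
  rw [this, inv_mul_cancel₀ (by positivity), ENNReal.ofReal_one]

/-- Completing the square: a product of two Gaussians factors through the Gaussian bridge, which
at the intermediate time is centred at the weighted mean of the end points. -/
theorem gaussProfile_mul_gaussProfile {d : ℕ} {a T₁ T₂ : ℝ} (ha : 0 < a) (hT₁ : 0 < T₁)
    (hT₂ : 0 < T₂) (x y z : EuclideanSpace ℝ (Fin d)) :
    gaussProfile d a T₁ ‖z - x‖ * gaussProfile d a T₂ ‖y - z‖ =
      gaussProfile d a (T₁ + T₂) ‖y - x‖ * gaussProfile d a (T₁ * T₂ / (T₁ + T₂))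
        ‖z - (T₁ + T₂)⁻¹ • (T₂ • x + T₁ • y)‖ := by
  have hT : 0 < T₁ + T₂ := by positivity
  have h1 : ‖y - x‖ ^ 2 = ‖z - x‖ ^ 2 + 2 * inner ℝ (z - x) (y - z) + ‖y - z‖ ^ 2 := by
    rw [← norm_add_sq_real]
    congr 2
    abel
  have h2 : ‖z - (T₁ + T₂)⁻¹ • (T₂ • x + T₁ • y)‖ ^ 2 = ((T₁ + T₂)⁻¹) ^ 2 *
      (T₂ ^ 2 * ‖z - x‖ ^ 2 - 2 * (T₁ * T₂) * inner ℝ (z - x) (y - z)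
        + T₁ ^ 2 * ‖y - z‖ ^ 2) := by
    have e : z - (T₁ + T₂)⁻¹ • (T₂ • x + T₁ • y) =
        (T₁ + T₂)⁻¹ • (T₂ • (z - x) - T₁ • (y - z)) := by
      have : z = (T₁ + T₂)⁻¹ • ((T₁ + T₂) • z) := by
        rw [smul_smul, inv_mul_cancel₀ hT.ne', one_smul]
      nth_rewrite 1 [this]
      rw [← smul_sub]
      congr 1
      module
    rw [e, norm_smul, mul_pow, norm_sub_sq_real, norm_smul, norm_smul, inner_smul_left,
      inner_smul_right, Real.norm_of_nonneg hT₁.le, Real.norm_of_nonneg hT₂.le,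
      Real.norm_of_nonneg (by positivity : 0 ≤ (T₁ + T₂)⁻¹)]
    simp only [conj_trivial]
    ring
  rw [gaussProfile_eq_exp d _ ha hT₁, gaussProfile_eq_exp d _ ha hT₂,
    gaussProfile_eq_exp d _ ha hT, gaussProfile_eq_exp d _ ha (by positivity),
    ← Real.exp_add, ← Real.exp_add, h1, h2, Real.log_div (by positivity) hT.ne',
    Real.log_mul hT₁.ne' hT₂.ne']
  congr 1
  field_simp
  ring

theorem isTransitionDensity_gaussKernel (d : ℕ) {a : ℝ} (ha : 0 < a) :
    IsTransitionDensity volume (gaussKernel d a) where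
  measurable := by
    unfold gaussKernel
    exact Measurable.ite (measurableSet_lt (by fun_prop) (by fun_prop)) (by fun_prop)
      measurable_const
  chapman_kolmogorov s u t x y hsu hut := by
    have e : ∀ z, gaussKernel d a s x u z * gaussKernel d a u z t y =
        ENNReal.ofReal (gaussProfile d a (t - s) ‖y - x‖) *
          ENNReal.ofReal (gaussProfile d a ((u - s) * (t - u) / ((u - s) + (t - u)))
            ‖z - ((u - s) + (t - u))⁻¹ • ((t - u) • x + (u - s) • y)‖) := by
      intro z
      have ht : t - s = (u - s) + (t - u) := by ring
      rw [gaussKernel_of_lt x z hsu, gaussKernel_of_lt z y hut, ht,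
        ← ENNReal.ofReal_mul (gaussProfile_pos d _ ha (by linarith)).le,
        ← ENNReal.ofReal_mul (gaussProfile_pos d _ ha (by linarith)).le,
        gaussProfile_mul_gaussProfile ha (by linarith) (by linarith)]
    have h1 : 0 < u - s := by linarith
    have h2 : 0 < t - u := by linarith
    rw [lintegral_congr e, lintegral_const_mul' _ _ ENNReal.ofReal_ne_top,
      lintegral_gaussProfile ha (by positivity), mul_one, gaussKernel_of_lt x y (hsu.trans hut)]

theorem gaussKernel_le_mul {d : ℕ} {a b : ℝ} (ha : 0 < a) (hab : a < b) {s t : ℝ}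
    (x y : EuclideanSpace ℝ (Fin d)) (hst : s < t) :
    gaussKernel d b s x t y ≤
      ENNReal.ofReal ((b / a) ^ ((d : ℝ) / 2)) * gaussKernel d a s x t y := by
  have hb : 0 < b := ha.trans hab
  have hT : 0 < t - s := by linarith
  rw [gaussKernel_of_lt x y hst, gaussKernel_of_lt x y hst,
    ← ENNReal.ofReal_mul (by positivity), gaussProfile_eq_exp d _ ha hT,
    gaussProfile_eq_exp d _ hb hT, Real.rpow_def_of_pos (by positivity), ← Real.exp_add,
    Real.log_div hb.ne' ha.ne']
  refine ENNReal.ofReal_le_ofReal (Real.exp_le_exp.2 ?_)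
  have : a * ‖y - x‖ ^ 2 / (4 * (t - s)) ≤ b * ‖y - x‖ ^ 2 / (4 * (t - s)) := by gcongr
  linarith

/-! ### The 4G inequality -/

theorem bddAbove_fourGExponent {α : ℝ} (hα : 0 < α) :
    BddAbove ((fun τ : ℝ => Real.log (1 + τ) - (τ - α) / (1 + τ) * Real.log (α * τ)) ''
      Ici (max α (1 / α))) := by
  refine ⟨1 / α + (1 + α) * α, ?_⟩
  rintro _ ⟨τ, hτ, rfl⟩
  have hτα : α ≤ τ := (le_max_left _ _).trans hτ
  have hτ0 : 0 < τ := hα.trans_le hτα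
  have e : Real.log (1 + τ) - (τ - α) / (1 + τ) * Real.log (α * τ) =
      Real.log ((1 + τ) / (α * τ)) + (1 + α) / (1 + τ) * Real.log (α * τ) := by
    rw [Real.log_div (by positivity) (by positivity)]
    field_simp
    ring
  have h1τ : 1 ≤ α * τ := by
    have : 1 / α ≤ τ := (le_max_right _ _).trans hτ
    rwa [div_le_iff₀ hα, mul_comm] at this
  have h1 : Real.log ((1 + τ) / (α * τ)) ≤ 1 / α := by
    refine (Real.log_le_sub_one_of_pos (by positivity)).trans ?_
    rw [sub_le_iff_le_add, div_le_iff₀ (by positivity)]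
    have : (1 / α + 1) * (α * τ) = τ + α * τ := by field_simp
    linarith
  have h2 : (1 + α) / (1 + τ) * Real.log (α * τ) ≤ (1 + α) * α := by
    rw [div_mul_eq_mul_div, div_le_iff₀ (by positivity), mul_assoc]
    refine mul_le_mul_of_nonneg_left ?_ (by positivity)
    refine (Real.log_le_sub_one_of_pos (by positivity)).trans ?_
    linarith
  show Real.log (1 + τ) - (τ - α) / (1 + τ) * Real.log (α * τ) ≤ _
  rw [e]
  exact add_le_add h1 h2

theorem le_fourGExponent {α τ : ℝ} (hα : 0 < α) (hτ : max α (1 / α) ≤ τ) :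
    Real.log (1 + τ) - (τ - α) / (1 + τ) * Real.log (α * τ) ≤ fourGExponent α :=
  le_csSup (bddAbove_fourGExponent hα) (mem_image_of_mem _ hτ)

/-- The scalar form of the 4G inequality. With `w = |z-x|/(u-s)`, `v = |y-z|/(t-u)` and
`τ = (u-s)/(t-u)`, the first alternative lets `g_{b-a}(s,x,u,z)` and the second one lets
`g_a(u,z,t,y)` serve as the majorant. -/
theorem fourG_alternative {α τ k : ℝ} (hα : 0 < α) (hτ : 0 < τ) (hk : 0 ≤ k) (w v : ℝ) :
    Real.log (1 + τ) - k * τ * (w - v) ^ 2 / (1 + τ) ≤ fourGExponent α ∨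
    Real.log (1 + τ) - Real.log (α * τ) +
      k * ((τ * w + v) ^ 2 / (1 + τ) - (1 + 1 / α) * τ * w ^ 2) ≤ fourGExponent α := by
  rcases le_total τ (max α (1 / α)) with h | h
  · left
    -- at `τ₀ = max α (1 / α)`, either `τ₀ = α` or `α * τ₀ = 1`, so the subtracted term vanishes
    have h0 := le_fourGExponent hα (le_refl (max α (1 / α)))
    have hz : (max α (1 / α) - α) * Real.log (α * max α (1 / α)) = 0 := by
      rcases max_choice α (1 / α) with h' | h' <;> rw [h']
      · simp
      · rw [mul_one_div_cancel hα.ne', Real.log_one, mul_zero]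
    rw [div_mul_eq_mul_div, hz, zero_div, sub_zero] at h0
    have h1 : Real.log (1 + τ) ≤ Real.log (1 + max α (1 / α)) :=
      Real.log_le_log (by positivity) (by linarith)
    have h2 : 0 ≤ k * τ * (w - v) ^ 2 / (1 + τ) := by positivity
    linarith
  · have hL := le_fourGExponent hα h
    set ℓ := Real.log (α * τ) with hℓ
    have hτα : α ≤ τ := (le_max_left _ _).trans h
    by_cases hc : (τ - α) * ℓ ≤ k * τ * (w - v) ^ 2
    · left
      refine le_trans ?_ hL
      rw [div_mul_eq_mul_div]
      gcongr
    · right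
      push Not at hc
      refine le_trans ?_ hL
      have hlt : 0 < τ - α := by
        refine (sub_nonneg.2 hτα).lt_of_ne fun h0 => ?_
        rw [← h0, zero_mul] at hc
        exact absurd hc (not_lt.2 (by positivity))
      -- weighted Cauchy-Schwarz for `τ w + v = (1 + τ) w + (v - w)`, with the weights chosen
      -- so that the `w ^ 2` terms cancel
      have key : (τ - α) * (k * ((τ * w + v) ^ 2 - (1 + τ) * (1 + 1 / α) * τ * w ^ 2)) ≤
          (1 + α) * (k * τ * (w - v) ^ 2) := by
        have e : (1 + α) * (k * τ * (w - v) ^ 2) -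
            (τ - α) * (k * ((τ * w + v) ^ 2 - (1 + τ) * (1 + 1 / α) * τ * w ^ 2)) =
            k / α * ((τ - α) * w - α * (v - w)) ^ 2 * (1 + τ) := by
          field_simp
          ring
        have : 0 ≤ k / α * ((τ - α) * w - α * (v - w)) ^ 2 * (1 + τ) := by positivity
        linarith
      have h3 : k * ((τ * w + v) ^ 2 - (1 + τ) * (1 + 1 / α) * τ * w ^ 2) ≤ (1 + α) * ℓ := by
        refine le_of_mul_le_mul_left ?_ hlt
        refine key.trans ?_
        have : (1 + α) * (k * τ * (w - v) ^ 2) ≤ (1 + α) * ((τ - α) * ℓ) := by gcongr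
        linarith
      have h4 : k * ((τ * w + v) ^ 2 / (1 + τ) - (1 + 1 / α) * τ * w ^ 2) ≤
          (1 + α) * ℓ / (1 + τ) := by
        rw [le_div_iff₀ (by positivity)]
        refine le_trans (le_of_eq ?_) h3
        field_simp
      have h5 : (τ - α) / (1 + τ) * ℓ = ℓ - (1 + α) * ℓ / (1 + τ) := by
        field_simp
        ring
      linarith

/-- The 4G inequality in terms of times and distances, obtained by comparing logarithms. -/
theorem gaussProfile_mul_le_max {d : ℕ} (hd : 1 ≤ d) {a b T₁ T₂ : ℝ} (ha : 0 < a) (hab : a < b)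
    (hT₁ : 0 < T₁) (hT₂ : 0 < T₂) (R₁ R₂ : ℝ) :
    gaussProfile d b T₁ R₁ * gaussProfile d a T₂ R₂ ≤ fourGConst d a b *
      max (gaussProfile d (b - a) T₁ R₁) (gaussProfile d a T₂ R₂) *
        gaussProfile d a (T₁ + T₂) (R₁ + R₂) := by
  have hb : 0 < b := ha.trans hab
  have hba : 0 < b - a := by linarith
  have hT : 0 < T₁ + T₂ := by positivity
  have hd0 : (0 : ℝ) < d := by exact_mod_cast hd
  have hM : fourGConst d a b = Real.exp ((d : ℝ) / 2 * (Real.log b - Real.log (b - a)) +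
      (d : ℝ) / 2 * fourGExponent (a / (b - a))) := by
    rw [fourGConst, Real.rpow_def_of_pos (by positivity), ← Real.exp_add,
      Real.log_div hb.ne' hba.ne', mul_comm ((d : ℝ) / 2) (Real.log b - _)]
  have hlog1 : Real.log (1 + T₁ / T₂) = Real.log (T₁ + T₂) - Real.log T₂ := by
    rw [← Real.log_div hT.ne' hT₂.ne']
    congr 1
    field_simp
    ring
  have hlog2 : Real.log (a / (b - a) * (T₁ / T₂)) =
      Real.log a - Real.log (b - a) + (Real.log T₁ - Real.log T₂) := by
    rw [Real.log_mul (by positivity) (by positivity), Real.log_div ha.ne' hba.ne',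
      Real.log_div hT₁.ne' hT₂.ne']
  have hM0 : 0 ≤ fourGConst d a b := by rw [hM]; positivity
  rcases fourG_alternative (α := a / (b - a)) (τ := T₁ / T₂) (k := a * T₂ / (2 * d))
    (by positivity) (by positivity) (by positivity) (R₁ / T₁) (R₂ / T₂) with h | h
  · refine le_trans ?_ (mul_le_mul_of_nonneg_right (mul_le_mul_of_nonneg_left
      (le_max_left _ _) hM0) (gaussProfile_pos d _ ha hT).le)
    rw [hM, gaussProfile_eq_exp d _ hb hT₁, gaussProfile_eq_exp d _ ha hT₂,
      gaussProfile_eq_exp d _ hba hT₁, gaussProfile_eq_exp d _ ha hT, ← Real.exp_add,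
      ← Real.exp_add, ← Real.exp_add, Real.exp_le_exp]
    rw [hlog1] at h
    have h' := mul_le_mul_of_nonneg_left h (by positivity : 0 ≤ (d : ℝ) / 2)
    have e : (d : ℝ) / 2 * (a * T₂ / (2 * d) * (T₁ / T₂) * (R₁ / T₁ - R₂ / T₂) ^ 2 /
        (1 + T₁ / T₂)) = b * R₁ ^ 2 / (4 * T₁) + a * R₂ ^ 2 / (4 * T₂) -
          (b - a) * R₁ ^ 2 / (4 * T₁) - a * (R₁ + R₂) ^ 2 / (4 * (T₁ + T₂)) := by
      have : T₂ + T₁ ≠ 0 := by positivity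
      field_simp
      ring
    rw [mul_sub, e] at h'
    linarith
  · refine le_trans ?_ (mul_le_mul_of_nonneg_right (mul_le_mul_of_nonneg_left
      (le_max_right _ _) hM0) (gaussProfile_pos d _ ha hT).le)
    rw [hM, gaussProfile_eq_exp d _ hb hT₁, gaussProfile_eq_exp d _ ha hT₂,
      gaussProfile_eq_exp d _ ha hT, ← Real.exp_add,
      ← Real.exp_add, ← Real.exp_add, Real.exp_le_exp]
    rw [hlog1, hlog2] at h
    have h' := mul_le_mul_of_nonneg_left h (by positivity : 0 ≤ (d : ℝ) / 2)
    have e : (d : ℝ) / 2 * (a * T₂ / (2 * d) * ((T₁ / T₂ * (R₁ / T₁) + R₂ / T₂) ^ 2 /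
        (1 + T₁ / T₂) - (1 + 1 / (a / (b - a))) * (T₁ / T₂) * (R₁ / T₁) ^ 2)) =
          a * (R₁ + R₂) ^ 2 / (4 * (T₁ + T₂)) - b * R₁ ^ 2 / (4 * T₁) := by
      have : T₂ + T₁ ≠ 0 := by positivity
      field_simp
      ring
    rw [mul_add, e] at h'
    linarith

theorem fourGConst_pos (d : ℕ) {a b : ℝ} (ha : 0 < a) (hab : a < b) : 0 < fourGConst d a b := by
  have hba : 0 < b - a := by linarith
  have hb : 0 < b := ha.trans hab
  unfold fourGConst
  positivity

/-- The 4G inequality for Gaussian kernels. -/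
theorem gaussKernel_mul_le {d : ℕ} (hd : 1 ≤ d) {a b : ℝ} (ha : 0 < a) (hab : a < b)
    {s u t : ℝ} (hsu : s < u) (hut : u < t) (x y z : EuclideanSpace ℝ (Fin d)) :
    gaussKernel d b s x u z * gaussKernel d a u z t y ≤
      ENNReal.ofReal (fourGConst d a b) * gaussKernel d a s x t y *
        (gaussKernel d (b - a) s x u z + gaussKernel d a u z t y) := by
  have hba : 0 < b - a := by linarith
  have hM := fourGConst_pos d ha hab
  have h1 : 0 < u - s := by linarith
  have h2 : 0 < t - u := by linarith
  have hle := gaussProfile_mul_le_max hd ha hab h1 h2 ‖z - x‖ ‖y - z‖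
  have hts : u - s + (t - u) = t - s := by ring
  rw [hts] at hle
  rw [gaussKernel_of_lt x z hsu, gaussKernel_of_lt z y hut, gaussKernel_of_lt x z hsu,
    gaussKernel_of_lt x y (hsu.trans hut), ← ENNReal.ofReal_add
      (gaussProfile_pos d _ hba h1).le (gaussProfile_pos d _ ha h2).le,
    ← ENNReal.ofReal_mul (gaussProfile_pos d _ (ha.trans hab) h1).le,
    ← ENNReal.ofReal_mul hM.le, ← ENNReal.ofReal_mul
      (mul_pos hM (gaussProfile_pos d _ ha (by linarith))).le]
  refine ENNReal.ofReal_le_ofReal (hle.trans ?_)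
  have hmax : max (gaussProfile d (b - a) (u - s) ‖z - x‖) (gaussProfile d a (t - u) ‖y - z‖) ≤
      gaussProfile d (b - a) (u - s) ‖z - x‖ + gaussProfile d a (t - u) ‖y - z‖ :=
    max_le_add_of_nonneg (gaussProfile_pos d _ hba h1).le (gaussProfile_pos d _ ha h2).le
  have htri : gaussProfile d a (t - s) (‖z - x‖ + ‖y - z‖) ≤
      gaussProfile d a (t - s) ‖y - x‖ := by
    refine gaussProfile_antitoneOn d ha (by linarith) (norm_nonneg _)
      (add_nonneg (norm_nonneg _) (norm_nonneg _)) ?_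
    calc ‖y - x‖ = ‖(z - x) + (y - z)‖ := by congr 1; abel
      _ ≤ _ := norm_add_le _ _
  have hs0 : 0 ≤ gaussProfile d (b - a) (u - s) ‖z - x‖ + gaussProfile d a (t - u) ‖y - z‖ :=
    add_nonneg (gaussProfile_pos d _ hba h1).le (gaussProfile_pos d _ ha h2).le
  have hG0 := (gaussProfile_pos d (‖z - x‖ + ‖y - z‖) ha (show 0 < t - s by linarith)).le
  calc _ ≤ fourGConst d a b * (gaussProfile d (b - a) (u - s) ‖z - x‖ +
        gaussProfile d a (t - u) ‖y - z‖) * gaussProfile d a (t - s) ‖y - x‖ := by gcongr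
    _ = _ := by ring

/-! ### Potentials of Kato type -/

/-- The time integral of the Gaussian kernel is a multiple of the Newtonian kernel; the
substitution `T ↦ 1 / T` turns it into the Gamma integral. -/
theorem integral_gaussProfile {d : ℕ} (hd : 3 ≤ d) {a R : ℝ} (ha : 0 < a) (hR : 0 < R) :
    ∫ T in Ioi 0, gaussProfile d a T R = a * c0 d / R ^ ((d : ℝ) - 2) := by
  have hpi := Real.pi_pos
  have hd' : (3 : ℝ) ≤ d := by exact_mod_cast hd
  rw [← integral_comp_rpow_Ioi (fun T => gaussProfile d a T R) (p := -1) (by norm_num)]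
  have e : ∀ T ∈ Ioi (0 : ℝ), (|(-1 : ℝ)| * T ^ ((-1 : ℝ) - 1)) • gaussProfile d a (T ^ (-1 : ℝ)) R
      = (4 * Real.pi / a) ^ (-((d : ℝ) / 2)) *
        (T ^ (((d : ℝ) / 2 - 1) - 1) * Real.exp (-(a * R ^ 2 / 4 * T))) := by
    intro T hT
    have hT : 0 < T := hT
    have e1 : 4 * Real.pi * T ^ (-1 : ℝ) / a = 4 * Real.pi / a * T ^ (-1 : ℝ) := by ring
    have e2 : R ^ 2 / (4 * T ^ (-1 : ℝ) / a) = a * R ^ 2 / 4 * T := by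
      rw [Real.rpow_neg_one]
      field_simp
    have e3 : T ^ (((d : ℝ) / 2 - 1) - 1) =
        T ^ ((-1 : ℝ) - 1) * (T ^ (-1 : ℝ)) ^ (-((d : ℝ) / 2)) := by
      rw [← Real.rpow_mul hT.le, ← Real.rpow_add hT]
      ring_nf
    rw [gaussProfile, e1, e2, e3, Real.mul_rpow (by positivity) (by positivity), smul_eq_mul,
      abs_neg, abs_one]
    ring
  rw [setIntegral_congr_fun measurableSet_Ioi e, integral_const_mul,
    Real.integral_rpow_mul_exp_neg_mul_Ioi (by linarith) (by positivity), c0]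
  have e4 : (4 * Real.pi / a) ^ (-((d : ℝ) / 2)) =
      Real.pi ^ (-((d : ℝ) / 2)) * (4 / a) ^ (-((d : ℝ) / 2)) := by
    rw [← Real.mul_rpow (by positivity) (by positivity)]
    congr 1
    ring
  have e5 : (1 / (a * R ^ 2 / 4)) ^ ((d : ℝ) / 2 - 1) =
      (4 / a) ^ ((d : ℝ) / 2 - 1) * (R ^ ((d : ℝ) - 2))⁻¹ := by
    have : R ^ ((d : ℝ) - 2) = (R ^ 2) ^ ((d : ℝ) / 2 - 1) := by
      rw [← Real.rpow_natCast, ← Real.rpow_mul hR.le]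
      congr 1
      push_cast
      ring
    rw [this, ← Real.inv_rpow (by positivity), ← Real.mul_rpow (by positivity) (by positivity)]
    congr 1
    field_simp
  have e6 : (4 / a) ^ (-((d : ℝ) / 2)) * (4 / a) ^ ((d : ℝ) / 2 - 1) = a / 4 := by
    rw [← Real.rpow_add (by positivity)]
    have : -((d : ℝ) / 2) + ((d : ℝ) / 2 - 1) = -1 := by ring
    rw [this, Real.rpow_neg_one, inv_div]
  rw [e4, e5]
  linear_combination (Real.pi ^ (-((d : ℝ) / 2)) * (R ^ ((d : ℝ) - 2))⁻¹ *
    Real.Gamma ((d : ℝ) / 2 - 1)) * e6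

theorem c0_pos {d : ℕ} (hd : 3 ≤ d) : 0 < c0 d := by
  have hd' : (3 : ℝ) ≤ d := by exact_mod_cast hd
  have := Real.Gamma_pos_of_pos (show 0 < (d : ℝ) / 2 - 1 by linarith)
  have := Real.pi_pos
  unfold c0
  positivity

theorem lintegral_gaussProfile_time {d : ℕ} (hd : 3 ≤ d) {a R : ℝ} (ha : 0 < a) (hR : 0 < R) :
    ∫⁻ T in Ioi 0, ENNReal.ofReal (gaussProfile d a T R) =
      ENNReal.ofReal (a * c0 d) / ENNReal.ofReal (R ^ ((d : ℝ) - 2)) := by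
  have h := integral_gaussProfile hd ha hR
  have hc := c0_pos hd
  rw [← ENNReal.ofReal_div_of_pos (by positivity), ← h, ofReal_integral_eq_lintegral_ofReal]
  · refine .of_integral_ne_zero ?_
    rw [h]
    positivity
  · exact (ae_restrict_iff' measurableSet_Ioi).2
      (Filter.Eventually.of_forall fun T hT => (gaussProfile_pos d R ha hT).le)

/-- Averaging over balls: for `‖z - x‖ ≥ δ`, the ball of radius `δ / 2` about the point of the
segment `[x, z]` at distance `δ / 2` from `z` lies within `δ` of `z` and nowhere farther from `x`
than `z`, so the value of a radially decreasing kernel at `z` is at most its mean there. -/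
theorem volume_ball_mul_lintegral_le {d : ℕ} {δ : ℝ} (hδ : 0 < δ) {k : ℝ → ℝ≥0∞}
    (hk : AntitoneOn k (Ici 0)) (hkm : Measurable k)
    {U : EuclideanSpace ℝ (Fin d) → ℝ≥0∞} (hU : Measurable U) {K : ℝ≥0∞}
    (hK : ∀ w, ∫⁻ z in {z | ‖z - w‖ < δ}, U z ≤ K) (x : EuclideanSpace ℝ (Fin d)) :
    volume (Metric.ball (0 : EuclideanSpace ℝ (Fin d)) (δ / 2)) *
      ∫⁻ z in {z | δ ≤ ‖z - x‖}, k ‖z - x‖ * U z ≤ (∫⁻ w, k ‖w - x‖) * K := by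
  have hfar : MeasurableSet {z : EuclideanSpace ℝ (Fin d) | δ ≤ ‖z - x‖} :=
    measurableSet_le measurable_const (by fun_prop)
  have hnear : ∀ z : EuclideanSpace ℝ (Fin d),
      MeasurableSet {w : EuclideanSpace ℝ (Fin d) | ‖w - z‖ < δ} := fun z =>
    measurableSet_lt (by fun_prop) measurable_const
  have hmean : ∀ z ∈ {z : EuclideanSpace ℝ (Fin d) | δ ≤ ‖z - x‖},
      volume (Metric.ball (0 : EuclideanSpace ℝ (Fin d)) (δ / 2)) * k ‖z - x‖ ≤
        ∫⁻ w in {w | ‖w - z‖ < δ}, k ‖w - x‖ := by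
    intro z hz
    have hz : δ ≤ ‖z - x‖ := hz
    have hz0 : 0 < ‖z - x‖ := hδ.trans_le hz
    set θ : ℝ := δ / (2 * ‖z - x‖) with hθ
    have hθn : θ * ‖z - x‖ = δ / 2 := by rw [hθ]; field_simp
    have hθ0 : 0 ≤ θ := by positivity
    have hθ1 : θ ≤ 1 := by
      rw [hθ, div_le_one (by positivity)]
      linarith
    set c := z - θ • (z - x) with hc
    have hcz : ‖c - z‖ = δ / 2 := by
      rw [hc, sub_sub_cancel_left, norm_neg, norm_smul, Real.norm_of_nonneg hθ0, hθn]
    have hcx : ‖c - x‖ = ‖z - x‖ - δ / 2 := by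
      have : c - x = (1 - θ) • (z - x) := by rw [hc]; module
      rw [this, norm_smul, Real.norm_of_nonneg (by linarith), sub_mul, hθn, one_mul]
    rw [← Measure.addHaar_ball_center volume c, mul_comm, ← setLIntegral_const]
    calc ∫⁻ _ in Metric.ball c (δ / 2), k ‖z - x‖
        ≤ ∫⁻ w in Metric.ball c (δ / 2), k ‖w - x‖ := by
          refine setLIntegral_mono' measurableSet_ball fun w hw => ?_
          rw [mem_ball_iff_norm] at hw
          refine hk (norm_nonneg _) (norm_nonneg _) ?_
          have := norm_sub_le_norm_sub_add_norm_sub w c x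
          linarith
      _ ≤ _ := by
          refine lintegral_mono_set fun w hw => ?_
          rw [mem_ball_iff_norm] at hw
          have := norm_sub_le_norm_sub_add_norm_sub w c z
          simp only [mem_ofPred_eq]
          linarith
  have hkx : Measurable fun w : EuclideanSpace ℝ (Fin d) => k ‖w - x‖ := hkm.comp (by fun_prop)
  have hjm : Measurable fun v : EuclideanSpace ℝ (Fin d) × EuclideanSpace ℝ (Fin d) =>
      {v : EuclideanSpace ℝ (Fin d) × EuclideanSpace ℝ (Fin d) | ‖v.2 - v.1‖ < δ}.indicator
        (fun v => k ‖v.2 - x‖ * U v.1) v := by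
    refine Measurable.indicator ?_ (measurableSet_lt (by fun_prop) measurable_const)
    exact (hkm.comp (by fun_prop)).mul (hU.comp measurable_fst)
  have hV : volume (Metric.ball (0 : EuclideanSpace ℝ (Fin d)) (δ / 2)) ≠ ∞ :=
    measure_ball_lt_top.ne
  calc volume (Metric.ball (0 : EuclideanSpace ℝ (Fin d)) (δ / 2)) *
        ∫⁻ z in {z | δ ≤ ‖z - x‖}, k ‖z - x‖ * U z
      = ∫⁻ z in {z | δ ≤ ‖z - x‖},
          volume (Metric.ball (0 : EuclideanSpace ℝ (Fin d)) (δ / 2)) * k ‖z - x‖ * U z := by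
        rw [← lintegral_const_mul' _ _ hV]
        simp only [mul_assoc]
    _ ≤ ∫⁻ z in {z | δ ≤ ‖z - x‖}, (∫⁻ w in {w | ‖w - z‖ < δ}, k ‖w - x‖) * U z :=
        setLIntegral_mono' hfar fun z hz => mul_le_mul' (hmean z hz) le_rfl
    _ ≤ ∫⁻ z, (∫⁻ w in {w | ‖w - z‖ < δ}, k ‖w - x‖) * U z := setLIntegral_le_lintegral _ _
    _ = ∫⁻ z, ∫⁻ w, {v : EuclideanSpace ℝ (Fin d) × EuclideanSpace ℝ (Fin d) |
          ‖v.2 - v.1‖ < δ}.indicator (fun v => k ‖v.2 - x‖ * U v.1) (z, w) := by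
        refine lintegral_congr fun z => ?_
        rw [← lintegral_mul_const _ hkx, ← lintegral_indicator (hnear z)]
        rfl
    _ = ∫⁻ w, ∫⁻ z, {v : EuclideanSpace ℝ (Fin d) × EuclideanSpace ℝ (Fin d) |
          ‖v.2 - v.1‖ < δ}.indicator (fun v => k ‖v.2 - x‖ * U v.1) (z, w) :=
        lintegral_lintegral_swap hjm.aemeasurable
    _ = ∫⁻ w, k ‖w - x‖ * ∫⁻ z in {z | ‖z - w‖ < δ}, U z := by
        refine lintegral_congr fun w => ?_
        rw [← lintegral_const_mul _ hU, ← lintegral_indicator (hnear w)]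
        refine lintegral_congr fun z => ?_
        simp only [indicator, mem_ofPred_eq, norm_sub_rev w z]
    _ ≤ ∫⁻ w, k ‖w - x‖ * K := lintegral_mono fun w => mul_le_mul' le_rfl (hK w)
    _ = _ := lintegral_mul_const _ hkx

theorem lintegral_ball_le_katoSup {d : ℕ} (hd : 2 ≤ d) {δ : ℝ} (hδ : 0 < δ)
    (U : EuclideanSpace ℝ (Fin d) → ℝ≥0∞) (w : EuclideanSpace ℝ (Fin d)) :
    ∫⁻ z in {z | ‖z - w‖ < δ}, U z ≤ ENNReal.ofReal (δ ^ ((d : ℝ) - 2)) * katoSup d δ U := by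
  have hd' : (2 : ℝ) ≤ d := by exact_mod_cast hd
  have hD : ENNReal.ofReal (δ ^ ((d : ℝ) - 2)) ≠ 0 := by
    simpa using Real.rpow_pos_of_pos hδ _
  calc ∫⁻ z in {z | ‖z - w‖ < δ}, U z
      ≤ ∫⁻ z in {z | ‖z - w‖ < δ}, ENNReal.ofReal (δ ^ ((d : ℝ) - 2)) *
          (U z / ENNReal.ofReal (‖z - w‖ ^ ((d : ℝ) - 2))) := by
        refine setLIntegral_mono' (measurableSet_lt (by fun_prop) measurable_const)
          fun z hz => ?_
        have hz : ‖z - w‖ < δ := hz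
        calc U z = ENNReal.ofReal (δ ^ ((d : ℝ) - 2)) *
              (U z / ENNReal.ofReal (δ ^ ((d : ℝ) - 2))) :=
              (ENNReal.mul_div_cancel hD ENNReal.ofReal_ne_top).symm
          _ ≤ _ := by
              gcongr
    _ = ENNReal.ofReal (δ ^ ((d : ℝ) - 2)) *
          ∫⁻ z in {z | ‖z - w‖ < δ}, U z / ENNReal.ofReal (‖z - w‖ ^ ((d : ℝ) - 2)) :=
        lintegral_const_mul' _ _ ENNReal.ofReal_ne_top
    _ ≤ _ := by
        gcongr
        exact le_iSup (fun x : EuclideanSpace ℝ (Fin d) =>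
          ∫⁻ z in {z | ‖z - x‖ < δ}, U z / ENNReal.ofReal (‖z - x‖ ^ ((d : ℝ) - 2))) w

theorem halfBallVolume_pos (d : ℕ) : 0 < halfBallVolume d :=
  ENNReal.toReal_pos (Metric.measure_ball_pos _ _ (by norm_num)).ne' measure_ball_lt_top.ne

/-- The part of the heat potential away from `x` is bounded uniformly in time. -/
theorem lintegral_far_gaussProfile_le {d : ℕ} (hd : 3 ≤ d) {a h T : ℝ} (ha : 0 < a) (hh : 0 < h)
    (hT : 0 < T) {U : EuclideanSpace ℝ (Fin d) → ℝ≥0∞} (hU : Measurable U)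
    (x : EuclideanSpace ℝ (Fin d)) :
    ∫⁻ z in {z | √h ≤ ‖z - x‖}, ENNReal.ofReal (gaussProfile d a T ‖z - x‖) * U z ≤
      katoSup d (√h) U / ENNReal.ofReal (halfBallVolume d * h) := by
  have : Nonempty (Fin d) := ⟨⟨0, by omega⟩⟩
  have hδ : 0 < √h := Real.sqrt_pos.2 hh
  have hk : AntitoneOn (fun R => ENNReal.ofReal (gaussProfile d a T R)) (Ici 0) :=
    fun R hR R' hR' hle => ENNReal.ofReal_le_ofReal (gaussProfile_antitoneOn d ha hT hR hR' hle)
  have hkm : Measurable fun R => ENNReal.ofReal (gaussProfile d a T R) :=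
    (measurable_gaussProfile d a measurable_const measurable_id).ennreal_ofReal
  have key := volume_ball_mul_lintegral_le hδ hk hkm hU
    (lintegral_ball_le_katoSup (by omega) hδ U) x
  have hvol : volume (Metric.ball (0 : EuclideanSpace ℝ (Fin d)) (√h / 2)) =
      ENNReal.ofReal ((√h) ^ ((d : ℝ) - 2)) * ENNReal.ofReal (halfBallVolume d * h) := by
    have e : √h / 2 = √h * (1 / 2) := by ring
    have e2 : (√h) ^ d = (√h) ^ ((d : ℝ) - 2) * h := by
      nth_rewrite 3 [← Real.sq_sqrt hh.le]
      rw [← Real.rpow_natCast, ← Real.rpow_natCast, ← Real.rpow_add hδ]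
      push_cast
      ring_nf
    rw [e, Measure.addHaar_ball_mul volume _ hδ.le, finrank_euclideanSpace_fin, e2,
      halfBallVolume, ENNReal.ofReal_mul (by positivity),
      ENNReal.ofReal_mul ENNReal.toReal_nonneg, ENNReal.ofReal_toReal measure_ball_lt_top.ne]
    ring
  have hδd : ENNReal.ofReal ((√h) ^ ((d : ℝ) - 2)) ≠ 0 := by
    simpa using Real.rpow_pos_of_pos hδ _
  have hVh : ENNReal.ofReal (halfBallVolume d * h) ≠ 0 := by
    simpa using mul_pos (halfBallVolume_pos d) hh
  rw [lintegral_gaussProfile ha hT, one_mul, hvol, mul_assoc,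
    ENNReal.mul_le_mul_iff_right hδd ENNReal.ofReal_ne_top] at key
  rw [ENNReal.le_div_iff_mul_le (Or.inl hVh) (Or.inl ENNReal.ofReal_ne_top), mul_comm]
  exact key

theorem lintegral_near_gaussProfile_le {d : ℕ} (hd : 3 ≤ d) {a δ : ℝ} (ha : 0 < a)
    {U : EuclideanSpace ℝ (Fin d) → ℝ≥0∞} (hU : Measurable U)
    (x : EuclideanSpace ℝ (Fin d)) :
    ∫⁻ T in Ioi 0, ∫⁻ z in {z | ‖z - x‖ < δ},
        ENNReal.ofReal (gaussProfile d a T ‖z - x‖) * U z ≤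
      ENNReal.ofReal (a * c0 d) * katoSup d δ U := by
  have hd' : (3 : ℝ) ≤ d := by exact_mod_cast hd
  have hm : Measurable fun v : ℝ × EuclideanSpace ℝ (Fin d) =>
      ENNReal.ofReal (gaussProfile d a v.1 ‖v.2 - x‖) * U v.2 :=
    (measurable_gaussProfile d a (by fun_prop) (by fun_prop)).ennreal_ofReal.mul
      (hU.comp measurable_snd)
  rw [lintegral_lintegral_swap hm.aemeasurable]
  calc ∫⁻ z in {z | ‖z - x‖ < δ}, ∫⁻ T in Ioi 0,
        ENNReal.ofReal (gaussProfile d a T ‖z - x‖) * U z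
      ≤ ∫⁻ z in {z | ‖z - x‖ < δ}, ENNReal.ofReal (a * c0 d) *
          (U z / ENNReal.ofReal (‖z - x‖ ^ ((d : ℝ) - 2))) := by
        refine lintegral_mono fun z => ?_
        simp only
        rw [lintegral_mul_const _
          (measurable_gaussProfile d a measurable_id' measurable_const).ennreal_ofReal]
        rcases (norm_nonneg (z - x)).eq_or_lt with h0 | h0
        · -- at `z = x` the Newtonian kernel is infinite
          rw [← h0, Real.zero_rpow (by linarith), ENNReal.ofReal_zero]
          rcases eq_or_ne (U z) 0 with hz | hz
          · simp [hz]
          · rw [ENNReal.div_zero hz, ENNReal.mul_top]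
            · exact le_top
            · simpa using mul_pos ha (c0_pos hd)
        · rw [lintegral_gaussProfile_time hd ha h0]
          simp only [ENNReal.div_eq_inv_mul]
          exact le_of_eq (by ring)
    _ = ENNReal.ofReal (a * c0 d) *
          ∫⁻ z in {z | ‖z - x‖ < δ}, U z / ENNReal.ofReal (‖z - x‖ ^ ((d : ℝ) - 2)) :=
        lintegral_const_mul' _ _ ENNReal.ofReal_ne_top
    _ ≤ _ := by
        gcongr
        exact le_iSup (fun x : EuclideanSpace ℝ (Fin d) =>
          ∫⁻ z in {z | ‖z - x‖ < δ}, U z / ENNReal.ofReal (‖z - x‖ ^ ((d : ℝ) - 2))) x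

/-- The heat potential of `U` up to time `T₀`: the part of `U` near `x` is charged to the
Newtonian potential, the part away from `x` grows at most linearly in time. -/
theorem lintegral_gaussProfile_mul_le {d : ℕ} (hd : 3 ≤ d) {a h : ℝ} (ha : 0 < a) (hh : 0 < h)
    {U : EuclideanSpace ℝ (Fin d) → ℝ≥0∞} (hU : Measurable U)
    (x : EuclideanSpace ℝ (Fin d)) (T₀ : ℝ) :
    ∫⁻ T in Ioo 0 T₀, ∫⁻ z, ENNReal.ofReal (gaussProfile d a T ‖z - x‖) * U z ≤
      ENNReal.ofReal (a * c0 d) * katoSup d (√h) U +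
        ENNReal.ofReal T₀ * (katoSup d (√h) U / ENNReal.ofReal (halfBallVolume d * h)) := by
  have hnear : MeasurableSet {z : EuclideanSpace ℝ (Fin d) | ‖z - x‖ < √h} :=
    measurableSet_lt (by fun_prop) measurable_const
  have hcompl : {z : EuclideanSpace ℝ (Fin d) | ‖z - x‖ < √h}ᶜ = {z | √h ≤ ‖z - x‖} := by
    ext z
    simp
  have hm : Measurable fun v : ℝ × EuclideanSpace ℝ (Fin d) =>
      ENNReal.ofReal (gaussProfile d a v.1 ‖v.2 - x‖) * U v.2 :=
    (measurable_gaussProfile d a (by fun_prop) (by fun_prop)).ennreal_ofReal.mul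
      (hU.comp measurable_snd)
  calc _ = ∫⁻ T in Ioo 0 T₀, ((∫⁻ z in {z | ‖z - x‖ < √h},
          ENNReal.ofReal (gaussProfile d a T ‖z - x‖) * U z) +
          ∫⁻ z in {z | √h ≤ ‖z - x‖}, ENNReal.ofReal (gaussProfile d a T ‖z - x‖) * U z) := by
        refine lintegral_congr fun T => ?_
        rw [← hcompl, lintegral_add_compl _ hnear]
    _ = (∫⁻ T in Ioo 0 T₀, ∫⁻ z in {z | ‖z - x‖ < √h},
          ENNReal.ofReal (gaussProfile d a T ‖z - x‖) * U z) +
        ∫⁻ T in Ioo 0 T₀, ∫⁻ z in {z | √h ≤ ‖z - x‖},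
          ENNReal.ofReal (gaussProfile d a T ‖z - x‖) * U z :=
        lintegral_add_left hm.lintegral_prod_right' _
    _ ≤ _ := by
        refine add_le_add ?_ ?_
        · exact (lintegral_mono_set Ioo_subset_Ioi_self).trans
            (lintegral_near_gaussProfile_le hd ha hU x)
        · calc _ ≤ ∫⁻ _ in Ioo 0 T₀,
                katoSup d (√h) U / ENNReal.ofReal (halfBallVolume d * h) :=
                setLIntegral_mono' measurableSet_Ioo fun T hT =>
                  lintegral_far_gaussProfile_le hd ha hh hT.1 hU x
            _ = _ := by rw [setLIntegral_const, Real.volume_Ioo, sub_zero, mul_comm]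

theorem setLIntegral_Ioo_comp_sub_right (f : ℝ → ℝ≥0∞) (s t : ℝ) :
    ∫⁻ u in Ioo s t, f (u - s) = ∫⁻ T in Ioo 0 (t - s), f T := by
  rw [← lintegral_indicator measurableSet_Ioo, ← lintegral_indicator measurableSet_Ioo,
    ← lintegral_sub_right_eq_self ((Ioo 0 (t - s)).indicator f) s]
  refine lintegral_congr fun u => ?_
  simp [indicator]

theorem setLIntegral_Ioo_comp_sub_left (f : ℝ → ℝ≥0∞) (s t : ℝ) :
    ∫⁻ u in Ioo s t, f (t - u) = ∫⁻ T in Ioo 0 (t - s), f T := by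
  rw [← lintegral_indicator measurableSet_Ioo, ← lintegral_indicator measurableSet_Ioo,
    ← lintegral_sub_left_eq_self ((Ioo 0 (t - s)).indicator f) t]
  refine lintegral_congr fun u => ?_
  simp [indicator, and_comm]

theorem iteration_gaussKernel_le {d : ℕ} (hd : 3 ≤ d) {a b h : ℝ} (ha : 0 < a) (hab : a < b)
    (hh : 0 < h) {U : EuclideanSpace ℝ (Fin d) → ℝ≥0∞} (hU : Measurable U) {s t : ℝ}
    (x y : EuclideanSpace ℝ (Fin d)) (hst : s < t) :
    iteration volume (gaussKernel d b) (fun _ z => U z) (gaussKernel d a) s x t y ≤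
      ENNReal.ofReal (fourGConst d a b) *
        (ENNReal.ofReal (b * c0 d) * katoSup d (√h) U + 2 * (ENNReal.ofReal (t - s) *
          (katoSup d (√h) U / ENNReal.ofReal (halfBallVolume d * h)))) *
        gaussKernel d a s x t y := by
  have hba : 0 < b - a := by linarith
  have hc := c0_pos hd
  have hMG : ENNReal.ofReal (fourGConst d a b) * gaussKernel d a s x t y ≠ ∞ := by
    rw [gaussKernel_of_lt x y hst]
    exact ENNReal.mul_ne_top ENNReal.ofReal_ne_top ENNReal.ofReal_ne_top
  have hm : ∀ (c : ℝ) (w : EuclideanSpace ℝ (Fin d)),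
      Measurable fun v : ℝ × EuclideanSpace ℝ (Fin d) =>
      ENNReal.ofReal (gaussProfile d c v.1 ‖v.2 - w‖) * U v.2 := fun c w =>
    (measurable_gaussProfile d c (by fun_prop) (by fun_prop)).ennreal_ofReal.mul
      (hU.comp measurable_snd)
  have hmz : ∀ T : ℝ, Measurable fun z : EuclideanSpace ℝ (Fin d) =>
      ENNReal.ofReal (gaussProfile d (b - a) T ‖z - x‖) * U z := fun T =>
    (measurable_gaussProfile d (b - a) measurable_const (by fun_prop)).ennreal_ofReal.mul hU
  have hmT : Measurable fun T : ℝ => ∫⁻ z, ENNReal.ofReal (gaussProfile d (b - a) T ‖z - x‖) * U z :=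
    Measurable.lintegral_prod_right' (f := fun v : ℝ × EuclideanSpace ℝ (Fin d) =>
      ENNReal.ofReal (gaussProfile d (b - a) v.1 ‖v.2 - x‖) * U v.2) (hm (b - a) x)
  have hmu : Measurable fun u : ℝ => ∫⁻ z,
      ENNReal.ofReal (gaussProfile d (b - a) (u - s) ‖z - x‖) * U z :=
    hmT.comp (measurable_id.sub_const s)
  calc iteration volume (gaussKernel d b) (fun _ z => U z) (gaussKernel d a) s x t y
      ≤ ∫⁻ u in Ioo s t, ENNReal.ofReal (fourGConst d a b) * gaussKernel d a s x t y *
          ((∫⁻ z, ENNReal.ofReal (gaussProfile d (b - a) (u - s) ‖z - x‖) * U z) +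
            ∫⁻ z, ENNReal.ofReal (gaussProfile d a (t - u) ‖z - y‖) * U z) := by
        refine setLIntegral_mono' measurableSet_Ioo fun u hu => ?_
        rw [← lintegral_add_left (hmz _),
          ← lintegral_const_mul' _ _ hMG]
        refine lintegral_mono fun z => ?_
        calc gaussKernel d b s x u z * U z * gaussKernel d a u z t y
            = gaussKernel d b s x u z * gaussKernel d a u z t y * U z := by ring
          _ ≤ ENNReal.ofReal (fourGConst d a b) * gaussKernel d a s x t y *
              (gaussKernel d (b - a) s x u z + gaussKernel d a u z t y) * U z :=
              mul_le_mul' (gaussKernel_mul_le (by omega) ha hab hu.1 hu.2 x y z) le_rfl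
          _ = _ := by
              rw [gaussKernel_of_lt x z hu.1, gaussKernel_of_lt z y hu.2, norm_sub_rev y z]
              ring
    _ = ENNReal.ofReal (fourGConst d a b) * gaussKernel d a s x t y *
          ((∫⁻ T in Ioo 0 (t - s), ∫⁻ z,
              ENNReal.ofReal (gaussProfile d (b - a) T ‖z - x‖) * U z) +
            ∫⁻ T in Ioo 0 (t - s), ∫⁻ z, ENNReal.ofReal (gaussProfile d a T ‖z - y‖) * U z) := by
        rw [lintegral_const_mul' _ _ hMG, lintegral_add_left hmu,
          setLIntegral_Ioo_comp_sub_right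
            (fun T => ∫⁻ z, ENNReal.ofReal (gaussProfile d (b - a) T ‖z - x‖) * U z),
          setLIntegral_Ioo_comp_sub_left
            (fun T => ∫⁻ z, ENNReal.ofReal (gaussProfile d a T ‖z - y‖) * U z)]
    _ ≤ ENNReal.ofReal (fourGConst d a b) * gaussKernel d a s x t y *
          ((ENNReal.ofReal ((b - a) * c0 d) * katoSup d (√h) U + ENNReal.ofReal (t - s) *
              (katoSup d (√h) U / ENNReal.ofReal (halfBallVolume d * h))) +
            (ENNReal.ofReal (a * c0 d) * katoSup d (√h) U + ENNReal.ofReal (t - s) *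
              (katoSup d (√h) U / ENNReal.ofReal (halfBallVolume d * h)))) :=
        mul_le_mul' le_rfl (add_le_add (lintegral_gaussProfile_mul_le hd hba hh hU x _)
          (lintegral_gaussProfile_mul_le hd ha hh hU y _))
    _ = _ := by
        have e : ENNReal.ofReal (b * c0 d) =
            ENNReal.ofReal ((b - a) * c0 d) + ENNReal.ofReal (a * c0 d) := by
          rw [← ENNReal.ofReal_add (by positivity) (by positivity)]
          congr 1
          ring
        rw [e]
        ring

theorem regularSuperadditive_linear {c : ℝ} (hc : 0 ≤ c) :
    RegularSuperadditive fun s t => if s < t then (t - s) * c else 0 := by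
  have e : (fun s t : ℝ => if s < t then (t - s) * c else 0) =
      fun s t : ℝ => max (t - s) 0 * c := by
    funext s t
    split_ifs with h
    · rw [max_eq_left (by linarith)]
    · rw [max_eq_right (by linarith), zero_mul]
  rw [e]
  refine ⟨fun s t => by positivity, fun s u t hsu hut => ?_, fun s t h => ?_, fun s t => ?_,
    fun s t => ?_⟩
  · rw [max_eq_left (by linarith), max_eq_left (by linarith), max_eq_left (by linarith)]
    exact le_of_eq (by ring)
  · rw [max_eq_right (by linarith), zero_mul]
  · exact Continuous.continuousWithinAt (by fun_prop)
  · exact Continuous.continuousWithinAt (by fun_prop)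

theorem memN_gaussKernel_of_katoSup_lt_top {d : ℕ} (hd : 3 ≤ d) {a b h : ℝ} (ha : 0 < a)
    (hab : a < b) (hh : 0 < h) {q : EuclideanSpace ℝ (Fin d) → ℝ≥0∞} (hq : Measurable q)
    (hK : katoSup d (√h) q < ∞) :
    MemN volume (gaussKernel d b) (gaussKernel d a) ((b / a) ^ ((d : ℝ) / 2))
      (b * c0 d * fourGConst d a b * (katoSup d (√h) q).toReal)
      (fun s t => if s < t then
          (t - s) * (katoSup d (√h) q).toReal * (2 * fourGConst d a b) / (halfBallVolume d * h)
        else 0)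
      (fun _ z => q z) := by
  have hb : 0 < b := ha.trans hab
  have hM := fourGConst_pos d ha hab
  have hc := c0_pos hd
  have hV := halfBallVolume_pos d
  set K := (katoSup d (√h) q).toReal with hKdef
  have hK0 : 0 ≤ K := ENNReal.toReal_nonneg
  have hKe : katoSup d (√h) q = ENNReal.ofReal K := (ENNReal.ofReal_toReal hK.ne).symm
  refine ⟨hq.comp measurable_snd, isTransitionDensity_gaussKernel d hb,
    isTransitionDensity_gaussKernel d ha, ?_, by positivity, ?_,
    fun s t x y hst => gaussKernel_le_mul ha hab x y hst, fun s t x y hst => ?_⟩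
  · exact Real.one_le_rpow ((one_le_div ha).2 hab.le) (by positivity)
  · convert regularSuperadditive_linear
      (show 0 ≤ K * (2 * fourGConst d a b) / (halfBallVolume d * h) by positivity) using 5
    ring
  · have hT : 0 < t - s := by linarith
    refine (iteration_gaussKernel_le hd ha hab hh hq x y hst).trans ?_
    rw [if_pos hst, hKe]
    refine mul_le_mul' (le_of_eq ?_) le_rfl
    have two : (2 : ℝ≥0∞) = ENNReal.ofReal 2 := by simp
    rw [two, ← ENNReal.ofReal_div_of_pos (by positivity), ← ENNReal.ofReal_mul (by positivity),
      ← ENNReal.ofReal_mul (by positivity), ← ENNReal.ofReal_mul (by positivity),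
      ← ENNReal.ofReal_add (by positivity) (by positivity), ← ENNReal.ofReal_mul hM.le]
    congr 1
    ring

end SchrodingerPerturbation

open SchrodingerPerturbation in
theorem theorem3 (d : ℕ) (hd : 1 ≤ d) (a b : ℝ) (ha : 0 < a) (hab : a < b) :
    (∀ (Lam lam : ℝ) (p : ℝ → EuclideanSpace ℝ (Fin d) → ℝ → EuclideanSpace ℝ (Fin d) → ℝ≥0∞),
      1 ≤ Lam →
      IsTransitionDensity volume p →
      (∀ (s t : ℝ) (x y : EuclideanSpace ℝ (Fin d)), s < t →
        p s x t y ≤ ENNReal.ofReal (Lam * Real.exp (lam * (t - s))) * gaussKernel d b s x t y) →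
      ∀ C : ℝ, C = Lam * (b / a) ^ ((d : ℝ) / 2) →
      ∀ (q : ℝ → EuclideanSpace ℝ (Fin d) → ℝ≥0∞) (η : ℝ) (Q : ℝ → ℝ → ℝ),
        MemN volume (gaussKernel d b) (gaussKernel d a) (C / Lam) (η / Lam)
          (fun s t => Q s t / Lam) q →
        ∀ (s t : ℝ) (x y : EuclideanSpace ℝ (Fin d)) (ε : ℝ), s < t → 0 < ε → ε < 1 - η →
          perturbation volume p q s x t y ≤
            ENNReal.ofReal ((C / (1 - η - ε)) ^ (1 + Q s t / ε) * Real.exp (lam * (t - s))) *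
              gaussKernel d a s x t y) ∧
    (3 ≤ d →
      ∀ (h : ℝ) (q : EuclideanSpace ℝ (Fin d) → ℝ≥0∞), 0 < h → Measurable q →
        katoSup d (Real.sqrt h) q < ∞ →
        MemN volume (gaussKernel d b) (gaussKernel d a) ((b / a) ^ ((d : ℝ) / 2))
          (b * c0 d * fourGConst d a b * (katoSup d (Real.sqrt h) q).toReal)
          (fun s t => if s < t then
              (t - s) * (katoSup d (Real.sqrt h) q).toReal * (2 * fourGConst d a b) /
                (halfBallVolume d * h)
            else 0)
          (fun _ z => q z)) := by
  refine ⟨?_, fun hd3 h q hh hq hK => memN_gaussKernel_of_katoSup_lt_top hd3 ha hab hh hq hK⟩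
  intro Lam lam p hLam hp hle C _ q η Q hq s t x y ε hst hε hε1
  have hLam0 : Lam ≠ 0 := by linarith
  have hN := hq.of_le_exp_mul hp hLam hle
  simp only [mul_div_cancel₀ _ hLam0] at hN
  have hA : 0 ≤ C / (1 - η - ε) := div_nonneg (by linarith [hN.one_le]) (by linarith)
  rw [ENNReal.ofReal_mul (Real.rpow_nonneg hA _), mul_assoc]
  exact hN.perturbation_le hε hε1 x y hst
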